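/- Let $\mathbb F_q$ be a finite field of odd characteristic, let $\psi:\mathbb F_q\to\mathbb C^\times$ be a non-trivial additive character, let $\sigma$ be the quadratic character of $\mathbb F_q^\times$, and put $G_1=\sum_{z\in\mathbb F_q}\psi(\tfrac12z^2)$. Let $\mathsf{Symp}$ be the category of finite dimensional symplectic vector spaces $V=(V,\omega)$ over $\mathbb F_q$, with linear isomorphisms preserving the symplectic forms as morphisms; write $\dim V=2n$ and $\overline V=(V,-\omega)$. The Heisenberg group $H(V)$ is $V\times\mathbb F_q$ with $(v,z)\cdot(v',z')=(v+v',z+z'+\tfrac12\omega(v,v'))$. An oriented Lagrangian $L^\circ=(L,o_L)$ is a Lagrangian subspace $L\subset V$ with a non-zero vector $o_L\in\bigwedge^{top}L$; $OLag(V)$ is the set of these. Let $\mathcal H_{L^\circ}$ be the space of functions $f:H(V)\to\mathbb C$ with $f((0,z)\cdot h)=\psi(z)f(h)$ for $z\in\mathbb F_q$ and $f((l,0)\cdot h)=f(h)$ for $l\in L$; $H(V)$ acts on it by right translation. The canonical intertwining morphisms are the (unique) system of $H(V)$-equivariant isomorphisms $T_{M^\circ,L^\circ}:\mathcal H_{L^\circ}\to\mathcal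 H_{M^\circ}$, for $M^\circ,L^\circ\in OLag(V)$, such that $T_{N^\circ,M^\circ}\circ T_{M^\circ,L^\circ}=T_{N^\circ,L^\circ}$ for all $N^\circ,M^\circ,L^\circ$, and such that, whenever $L+M=V$, $$T_{M^\circ,L^\circ}[f](h)=(G_1/q)^n\,\sigma\big((-1)^{\binom n2}\omega_\wedge(o_L,o_M)\big)\sum_{m\in M}f((m,0)\cdot h),$$ where $\omega_\wedge(a_1\wedge\dots\wedge a_n,\,b_1\wedge\dots\wedge b_n)=\det(\omega(a_i,b_{n+1-j}))_{i,j}=(-1)^{\binom n2}\det(\omega(a_i,b_j))_{i,j}$. The canonical vector space $\mathcal H(V)$ is the space of families $(s_{L^\circ}\in\mathcal H_{L^\circ})_{L^\circ\in OLag(V)}$ with $T_{M^\circ,L^\circ}s_{L^\circ}=s_{M^\circ}$ for all $M^\circ,L^\circ$. A morphism $f:V\to U$ of $\mathsf{Symp}$ induces $\mathcal H(f):\mathcal H(U)\to\mathcal H(V)$ by $(\mathcal H(f)s)_{L^\circ}(v,z)=s_{f(L^\circ)}(f(v),z)$; the same linear map is a morphism $\overline f:\overline V\to\overline U$. Then there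 is a natural non-degenerate pairing: there exist bilinear maps, one for each $V\in\mathsf{Symp}$ (the same $\psi$ being used for $V$ and $\overline V$), $$\langle\cdot,\cdot\rangle_V:\mathcal H(\overline V)\times\mathcal H(V)\to\mathbb C,$$ each of which is non-degenerate (in both variables), such that for every morphism $f:V\to U$ of $\mathsf{Symp}$, every $x\in\mathcal H(\overline U)$ and every $y\in\mathcal H(U)$, $$\langle\mathcal H(\overline f)x,\ \mathcal H(f)y\rangle_V=\langle x,y\rangle_U .$$ -/

import Mathlib

open scoped BigOperators
open Module

universe u v

noncomputable section

/-- A finite dimensional symplectic vector space over the field `F`. -/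
structure Symp (F : Type v) [Field F] where
  carrier : Type u
  [addCommGroup : AddCommGroup carrier]
  [module : Module F carrier]
  [finite : Module.Finite F carrier]
  /-- the symplectic form `ω` -/
  form : LinearMap.BilinForm F carrier
  isAlt : form.IsAlt
  nondegenerate : form.Nondegenerate

namespace Symp

variable {F : Type v} [Field F]

instance : CoeSort (Symp.{u, v} F) (Type u) := ⟨Symp.carrier⟩
instance (V : Symp.{u, v} F) : AddCommGroup V := V.addCommGroup
instance (V : Symp.{u, v} F) : Module F V := V.module
instance (V : Symp.{u, v} F) : Module.Finite F V := V.finite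

/-- The half dimension `n` of `V`, where `dim V = 2n`. -/
def halfDim (V : Symp.{u, v} F) : ℕ := finrank F V / 2

/-- The symplectic dual `V̄ = (V, -ω)`. -/
def dual (V : Symp.{u, v} F) : Symp.{u, v} F where
  carrier := V
  form := -V.form
  isAlt := V.isAlt.neg
  nondegenerate :=
    ⟨fun x hx => V.nondegenerate.1 x fun y => by simpa using hx y,
      fun y hy => V.nondegenerate.2 y fun x => by simpa using hy x⟩

/-- Morphisms of the category of symplectic spaces: linear isomorphisms `V → U` which carry the
symplectic form of `V` to the symplectic form of `U`. -/
structure Iso (V U : Symp.{u, v} F) where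
  toEquiv : V ≃ₗ[F] U
  form_map : ∀ x y : V, U.form (toEquiv x) (toEquiv y) = V.form x y

/-- The inverse of an isomorphism of symplectic spaces. -/
def Iso.symm {V U : Symp.{u, v} F} (f : Iso V U) : Iso U V where
  toEquiv := f.toEquiv.symm
  form_map x y := by rw [← f.form_map]; simp

/-- The morphism `V̄ → Ū` with the same underlying map as `f : V → U`. -/
def Iso.dual {V U : Symp.{u, v} F} (f : Iso V U) : Iso V.dual U.dual where
  toEquiv := (f.toEquiv : V ≃ₗ[F] U)
  form_map x y := congrArg Neg.neg (f.form_map x y)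

theorem Iso.halfDim_eq {V U : Symp.{u, v} F} (f : Iso V U) : V.halfDim = U.halfDim := by
  unfold halfDim; rw [f.toEquiv.finrank_eq]

/-! ### The Heisenberg group -/

/-- The underlying set `V × F` of the Heisenberg group `H(V)`. -/
@[ext] structure Heis (V : Symp.{u, v} F) where
  vec : V
  cen : F

namespace Heis

variable {V : Symp.{u, v} F}

/-- The Heisenberg multiplication
`(v, z) · (v', z') = (v + v', z + z' + ½ ω(v, v'))`. -/
instance : Mul (Heis V) :=
  ⟨fun a b => ⟨a.vec + b.vec, a.cen + b.cen + 2⁻¹ * V.form a.vec b.vec⟩⟩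
instance : One (Heis V) := ⟨⟨0, 0⟩⟩
instance : Inv (Heis V) := ⟨fun a => ⟨-a.vec, -a.cen⟩⟩

@[simp] theorem mul_vec (a b : Heis V) : (a * b).vec = a.vec + b.vec := rfl
@[simp] theorem mul_cen (a b : Heis V) :
    (a * b).cen = a.cen + b.cen + 2⁻¹ * V.form a.vec b.vec := rfl
@[simp] theorem one_vec : (1 : Heis V).vec = 0 := rfl
@[simp] theorem one_cen : (1 : Heis V).cen = 0 := rfl
@[simp] theorem inv_vec (a : Heis V) : (a⁻¹).vec = -a.vec := rfl
@[simp] theorem inv_cen (a : Heis V) : (a⁻¹).cen = -a.cen := rfl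

instance : Group (Heis V) :=
  Group.ofLeftAxioms
    (fun a b c => by
      ext
      · simp [add_assoc]
      · simp only [mul_cen, mul_vec, map_add, LinearMap.add_apply]; ring)
    (fun a => by ext <;> simp)
    (fun a => by ext <;> simp [V.isAlt a.vec])

/-- The inclusion of the vectors as a subset of `H(V)`; it is a homomorphism on every isotropic
subspace. -/
def ofVec (w : V) : Heis V := ⟨w, 0⟩

/-- The inclusion of the center `Z = {(0, z)}`. -/
def ofCen (z : F) : Heis V := ⟨0, z⟩

@[simp] theorem ofVec_vec (w : V) : (ofVec w).vec = w := rfl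
@[simp] theorem ofVec_cen (w : V) : (ofVec w).cen = 0 := rfl
@[simp] theorem ofCen_vec (z : F) : (ofCen z : Heis V).vec = 0 := rfl
@[simp] theorem ofCen_cen (z : F) : (ofCen z : Heis V).cen = z := rfl

/-- The isomorphism `(v, z) ↦ (f v, z)` of Heisenberg groups induced by `f : V → U`. -/
def map {U : Symp.{u, v} F} (f : Iso V U) : Heis V →* Heis U where
  toFun a := ⟨f.toEquiv a.vec, a.cen⟩
  map_one' := by ext <;> simp
  map_mul' a b := by ext <;> simp [f.form_map]

theorem map_ofVec {U : Symp.{u, v} F} (f : Iso V U) (w : V) :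
    map f (ofVec w) = ofVec (f.toEquiv w) := rfl

theorem map_ofCen {U : Symp.{u, v} F} (f : Iso V U) (z : F) :
    map f (ofCen z) = ofCen z := by ext <;> simp [map]

theorem map_symm_map {U : Symp.{u, v} F} (f : Iso V U) (a : Heis V) :
    map f.symm (map f a) = a := by ext <;> simp [map, Iso.symm]

theorem map_map_symm {U : Symp.{u, v} F} (f : Iso V U) (a : Heis U) :
    map f (map f.symm a) = a := by ext <;> simp [map, Iso.symm]

end Heis

/-! ### Oriented Lagrangians -/

/-- An oriented Lagrangian `L° = (L, o_L)`: a Lagrangian subspace `L` (that is, `L = L^⊥`) with a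
nonzero vector `o_L` of the top exterior power of `L`. The line `⋀^top L` is regarded as
a subspace of the exterior algebra of `V`, through the (injective) map induced by `L ⊆ V`. -/
@[ext] structure OLag (V : Symp.{u, v} F) where
  space : Submodule F V
  isLagrangian : V.form.orthogonal space = space
  orient : ExteriorAlgebra F V
  orient_mem : orient ∈
    (⋀[F]^(finrank F space) space).map (ExteriorAlgebra.map space.subtype).toLinearMap
  orient_ne_zero : orient ≠ 0

namespace OLag

variable {V U : Symp.{u, v} F}

theorem finrank_space (L : OLag V) : finrank F L.space = V.halfDim := by
  have h := LinearMap.BilinForm.finrank_orthogonal V.nondegenerate L.space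
  rw [L.isLagrangian] at h
  have h' := Submodule.finrank_le L.space
  unfold halfDim
  omega

theorem map_exteriorPower_le {M N : Type*} [AddCommGroup M] [Module F M] [AddCommGroup N]
    [Module F N] (g : M →ₗ[F] N) (k : ℕ) :
    (⋀[F]^k M).map (ExteriorAlgebra.map g).toLinearMap ≤ ⋀[F]^k N := by
  change ((LinearMap.range (ExteriorAlgebra.ι F)) ^ k).map _ ≤
    (LinearMap.range (ExteriorAlgebra.ι F)) ^ k
  rw [Submodule.map_pow]
  refine pow_le_pow_left' ?_ k
  rintro _ ⟨_, ⟨m, rfl⟩, rfl⟩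
  exact ⟨g m, by simp⟩

/-- The orientation as an element of `⋀^n V`. -/
def orientV (L : OLag V) : ⋀[F]^V.halfDim V :=
  ⟨L.orient, by
    have h := map_exteriorPower_le _ _ L.orient_mem
    rwa [L.finrank_space] at h⟩

/-- The bijection `OLag(V) → OLag(U)` induced by an isomorphism `V → U`. -/
def map (f : Iso V U) (L : OLag V) : OLag U where
  space := L.space.map (f.toEquiv : V →ₗ[F] U)
  isLagrangian := by
    ext y
    obtain ⟨x, rfl⟩ := f.toEquiv.surjective y
    have h : x ∈ V.form.orthogonal L.space ↔ x ∈ L.space := by rw [L.isLagrangian]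
    rw [LinearMap.BilinForm.mem_orthogonal_iff] at h ⊢
    constructor
    · intro hx
      refine ⟨x, h.1 fun l hl => ?_, rfl⟩
      rw [← f.form_map]
      exact hx _ ⟨l, hl, rfl⟩
    · rintro ⟨x', hx', he⟩ _ ⟨l, hl, rfl⟩
      obtain rfl : x' = x := f.toEquiv.injective he
      exact (f.form_map l x').trans (h.2 hx' l hl)
  orient := ExteriorAlgebra.map (f.toEquiv : V →ₗ[F] U) L.orient
  orient_mem := by
    obtain ⟨a, ha, h⟩ := L.orient_mem
    rw [← h]
    let g : L.space →ₗ[F] L.space.map (f.toEquiv : V →ₗ[F] U) :=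
      (f.toEquiv.submoduleMap L.space : _ →ₗ[F] _)
    have hd : finrank F (L.space.map (f.toEquiv : V →ₗ[F] U)) = finrank F L.space :=
      (f.toEquiv.submoduleMap L.space).finrank_eq.symm
    refine ⟨ExteriorAlgebra.map g a, ?_, ?_⟩
    · rw [hd]
      exact map_exteriorPower_le g _ ⟨a, ha, rfl⟩
    · have hg : (L.space.map (f.toEquiv : V →ₗ[F] U)).subtype ∘ₗ g
          = (f.toEquiv : V →ₗ[F] U) ∘ₗ L.space.subtype := by ext; rfl
      have := congrArg (fun t => ExteriorAlgebra.map t a) hg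
      simp only [← ExteriorAlgebra.map_comp_map] at this
      exact this
  orient_ne_zero h := by
    apply L.orient_ne_zero
    have h2 : ExteriorAlgebra.map (f.toEquiv.symm : U →ₗ[F] V)
        (ExteriorAlgebra.map (f.toEquiv : V →ₗ[F] U) L.orient) = L.orient := by
      rw [← AlgHom.comp_apply, ExteriorAlgebra.map_comp_map]
      simp
    rw [← h2, h, map_zero]

theorem mem_map (f : Iso V U) (L : OLag V) (x : V) (hx : x ∈ L.space) :
    f.toEquiv x ∈ (L.map f).space := Submodule.mem_map_of_mem hx

theorem mem_of_mem_map_symm (f : Iso V U) (L : OLag U) (x : V) (hx : x ∈ (L.map f.symm).space) :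
    f.toEquiv x ∈ L.space := by
  obtain ⟨y, hy, rfl⟩ := hx
  have : f.toEquiv (f.toEquiv.symm y) ∈ L.space := by rwa [LinearEquiv.apply_symm_apply]
  exact this

theorem map_symm_map (f : Iso V U) (L : OLag V) : (L.map f).map f.symm = L := by
  ext1
  · ext x; simp [map, Iso.symm]
  · simp only [map, Iso.symm]
    rw [← AlgHom.comp_apply, ExteriorAlgebra.map_comp_map]
    simp

theorem map_map_symm (f : Iso V U) (L : OLag U) : (L.map f.symm).map f = L :=
  map_symm_map f.symm L

end OLag

/-- The pairing `ω_∧` on `⋀^k V` induced by the symplectic form, normalized by iterated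
contraction: `ω_∧(a₁ ∧ … ∧ a_k, b₁ ∧ … ∧ b_k) = det (ω(a_i, b_{k+1-j}))_{i,j}`, which is
`(-1)^(k choose 2) det (ω(a_i, b_j))_{i,j}`. The latter determinant is `exteriorPower.pairingDual`. -/
def wedgeForm (V : Symp.{u, v} F) (k : ℕ) (a b : ⋀[F]^k V) : F :=
  (-1) ^ (k.choose 2) * exteriorPower.pairingDual F V k (exteriorPower.map k V.form a) b

theorem wedgeForm_map {V U : Symp.{u, v} F} (f : Iso V U) (k : ℕ) (a b : ⋀[F]^k V) :
    U.wedgeForm k (exteriorPower.map k (f.toEquiv : V →ₗ[F] U) a)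
      (exteriorPower.map k (f.toEquiv : V →ₗ[F] U) b) = V.wedgeForm k a b := by
  unfold wedgeForm
  congr 1
  have key : (exteriorPower.pairingDual F U k ∘ₗ exteriorPower.map k U.form).compl₁₂
      (exteriorPower.map k (f.toEquiv : V →ₗ[F] U)) (exteriorPower.map k (f.toEquiv : V →ₗ[F] U))
      = exteriorPower.pairingDual F V k ∘ₗ exteriorPower.map k V.form := by
    refine exteriorPower.linearMap_ext (AlternatingMap.ext fun x => ?_)
    refine exteriorPower.linearMap_ext (AlternatingMap.ext fun y => ?_)
    simp [exteriorPower.map_apply_ιMulti, exteriorPower.pairingDual_ιMulti_ιMulti, f.form_map]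
  exact LinearMap.congr_fun (LinearMap.congr_fun key a) b

theorem wedgeForm_congr (V : Symp.{u, v} F) {k k' : ℕ} (h : k = k') (a b : ⋀[F]^k V)
    (a' b' : ⋀[F]^k' V) (ha : a.1 = a'.1) (hb : b.1 = b'.1) :
    V.wedgeForm k a b = V.wedgeForm k' a' b' := by
  subst h
  rw [Subtype.ext ha, Subtype.ext hb]

theorem coe_exteriorPower_map {M N : Type*} [AddCommGroup M] [Module F M] [AddCommGroup N]
    [Module F N] (g : M →ₗ[F] N) (k : ℕ) (a : ⋀[F]^k M) :
    (exteriorPower.map k g a : ExteriorAlgebra F N) = ExteriorAlgebra.map g a := by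
  have key : (⋀[F]^k N).subtype ∘ₗ exteriorPower.map k g
      = (ExteriorAlgebra.map g).toLinearMap ∘ₗ (⋀[F]^k M).subtype := by
    refine exteriorPower.linearMap_ext (AlternatingMap.ext fun x => ?_)
    simp [exteriorPower.map_apply_ιMulti, ExteriorAlgebra.map_apply_ιMulti]
  exact LinearMap.congr_fun key a

/-! ### Models of the Heisenberg representation -/

/-- The space `ℋ_{L°}`: functions `f` on `H(V)` with `f(z · h) = ψ(z) f(h)` for `z ∈ Z` and
`f(l · h) = f(h)` for `l ∈ L`. -/
def model (ψ : AddChar F ℂ) {V : Symp.{u, v} F} (L : OLag V) : Submodule ℂ (Heis V → ℂ) where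
  carrier := {f | (∀ z h, f (Heis.ofCen z * h) = ψ z * f h) ∧
    ∀ l ∈ L.space, ∀ h, f (Heis.ofVec l * h) = f h}
  add_mem' {f g} hf hg := ⟨fun z h => by simp [hf.1, hg.1, mul_add],
    fun l hl h => by simp [hf.2 l hl, hg.2 l hl]⟩
  zero_mem' := ⟨fun z h => by simp, fun l _ h => by simp⟩
  smul_mem' c f hf := ⟨fun z h => by simp [hf.1, mul_left_comm],
    fun l hl h => by simp [hf.2 l hl]⟩

/-- The Heisenberg action `π_{L°}` on `ℋ_{L°}` by right translation. -/
def heisRep (ψ : AddChar F ℂ) {V : Symp.{u, v} F} (L : OLag V) :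
    Representation ℂ (Heis V) (model ψ L) where
  toFun h :=
    { toFun := fun f => ⟨fun h' => f.1 (h' * h),
        fun z h' => (congrArg f.1 (mul_assoc _ h' h)).trans (f.2.1 z _),
        fun l hl h' => (congrArg f.1 (mul_assoc _ h' h)).trans (f.2.2 l hl _)⟩
      map_add' := fun _ _ => rfl
      map_smul' := fun _ _ => rfl }
  map_one' := by
    refine LinearMap.ext fun f => Subtype.ext (funext fun h' => ?_)
    exact congrArg f.1 (mul_one h')
  map_mul' a b := by
    refine LinearMap.ext fun f => Subtype.ext (funext fun h' => ?_)
    exact congrArg f.1 (mul_assoc h' a b).symm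

/-- Pull-back of functions along `H(V) → H(U)`, from `ℋ_{L'}(U)` to `ℋ_{L}(V)`, when `f` maps
`L` into `L'`. -/
def modelPullback (ψ : AddChar F ℂ) {V U : Symp.{u, v} F} (f : Iso V U) (L : OLag V) (L' : OLag U)
    (h : ∀ x ∈ L.space, f.toEquiv x ∈ L'.space) : model ψ L' →ₗ[ℂ] model ψ L where
  toFun s := ⟨fun a => s.1 (Heis.map f a),
    fun z a => by
      have := s.2.1 z (Heis.map f a)
      rwa [← Heis.map_ofCen f, ← map_mul] at this,
    fun l hl a => by
      have := s.2.2 _ (h l hl) (Heis.map f a)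
      rwa [← Heis.map_ofVec f, ← map_mul] at this⟩
  map_add' _ _ := rfl
  map_smul' _ _ := rfl

theorem modelPullback_symm (ψ : AddChar F ℂ) {V U : Symp.{u, v} F} (f : Iso V U) (L : OLag V)
    (L' : OLag U) (h : ∀ x ∈ L.space, f.toEquiv x ∈ L'.space)
    (h' : ∀ x ∈ L'.space, f.symm.toEquiv x ∈ L.space) (x : model ψ L) :
    modelPullback ψ f L L' h (modelPullback ψ f.symm L' L h' x) = x :=
  Subtype.ext (funext fun a => congrArg x.1 (Heis.map_symm_map f a))

theorem modelPullback_heisRep (ψ : AddChar F ℂ) {V U : Symp.{u, v} F} (f : Iso V U) (L : OLag V)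
    (L' : OLag U) (h : ∀ x ∈ L.space, f.toEquiv x ∈ L'.space) (a : Heis V) (x : model ψ L') :
    modelPullback ψ f L L' h (heisRep ψ L' (Heis.map f a) x)
      = heisRep ψ L a (modelPullback ψ f L L' h x) :=
  Subtype.ext (funext fun b => congrArg x.1 (map_mul (Heis.map f) b a).symm)

theorem modelPullback_bijective (ψ : AddChar F ℂ) {V U : Symp.{u, v} F} (f : Iso V U) (L : OLag V)
    (L' : OLag U) (h : ∀ x ∈ L.space, f.toEquiv x ∈ L'.space)
    (h' : ∀ x ∈ L'.space, f.symm.toEquiv x ∈ L.space) :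
    Function.Bijective (modelPullback ψ f L L' h) :=
  ⟨Function.LeftInverse.injective (g := modelPullback ψ f.symm L' L h')
      (modelPullback_symm ψ f.symm L' L h' h),
    Function.RightInverse.surjective (g := modelPullback ψ f.symm L' L h')
      (modelPullback_symm ψ f L L' h h')⟩

/-! ### The canonical intertwining morphisms -/

section Canonical

variable [Fintype F] [DecidableEq F]

/-- The one dimensional Gauss sum `G₁ = ∑_z ψ(½ z²)`. -/
def gaussSumOne (ψ : AddChar F ℂ) : ℂ := ∑ z : F, ψ (2⁻¹ * z ^ 2)

/-- The normalization constant
`A_{M°,L°} = (G₁ / q)^n σ((-1)^(n choose 2) ω_∧(o_L, o_M))`,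
where `σ` is the quadratic character of `F`. -/
def normConst (ψ : AddChar F ℂ) {V : Symp.{u, v} F} (M L : OLag V) : ℂ :=
  (gaussSumOne ψ / (Fintype.card F : ℂ)) ^ V.halfDim *
    ((quadraticChar F ((-1) ^ (V.halfDim.choose 2) *
      V.wedgeForm V.halfDim L.orientV M.orientV) : ℤ) : ℂ)

/-- A trivialization of the bundle of models on `OLag(V)`: a multiplicative system of
intertwining isomorphisms `T_{M°,L°} : ℋ_{L°} → ℋ_{M°}`. -/
structure IsTrivialization (ψ : AddChar F ℂ) {V : Symp.{u, v} F}
    (T : ∀ M L : OLag V, model ψ L →ₗ[ℂ] model ψ M) : Prop where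
  bijective : ∀ M L, Function.Bijective (T M L)
  intertwines : ∀ M L h f, T M L (heisRep ψ L h f) = heisRep ψ M h (T M L f)
  mul : ∀ N M L, T N M ∘ₗ T M L = T N L

/-- The system of canonical intertwining morphisms: the trivialization which on pairs in general
position, `L + M = V`, is given by `T_{M°,L°} f (h) = A_{M°,L°} ∑_{m ∈ M} f(m · h)`.
(The sum is over a finite set.) -/
structure IsCanonical (ψ : AddChar F ℂ) {V : Symp.{u, v} F}
    (T : ∀ M L : OLag V, model ψ L →ₗ[ℂ] model ψ M) : Prop extends IsTrivialization ψ T where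
  apply_of_sup_eq_top : ∀ M L : OLag V, L.space ⊔ M.space = ⊤ → ∀ (f : model ψ L) (h : Heis V),
    (T M L f).1 h = normConst ψ M L * ∑ᶠ m : M.space, f.1 (Heis.ofVec (m : V) * h)

/-- The canonical vector space `ℋ(V) = ℋ(V, ψ)`: the space of horizontal sections, that is
systems `(v_{L°} ∈ ℋ_{L°})` with `T_{M°,L°} v_{L°} = v_{M°}` for all `(M°, L°)`, where `T` is
the system of canonical intertwining morphisms. -/
def canonicalSpace (ψ : AddChar F ℂ) (V : Symp.{u, v} F) :
    Submodule ℂ (∀ L : OLag V, model ψ L) where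
  carrier := {s | ∀ T : ∀ M L : OLag V, model ψ L →ₗ[ℂ] model ψ M, IsCanonical ψ T →
    ∀ M L, T M L (s L) = s M}
  add_mem' hs ht T hT M L := by simp [hs T hT M L, ht T hT M L]
  zero_mem' T hT M L := by simp
  smul_mem' c s hs T hT M L := by simp [hs T hT M L]

/-! ### Functoriality -/

theorem normConst_map (ψ : AddChar F ℂ) {V U : Symp.{u, v} F} (f : Iso V U) (M L : OLag V) :
    normConst ψ (M.map f) (L.map f) = normConst ψ M L := by
  unfold normConst
  rw [← wedgeForm_map f]
  rw [wedgeForm_congr U f.halfDim_eq _ _ (L.map f).orientV (M.map f).orientV, f.halfDim_eq]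
  · rw [coe_exteriorPower_map]; rfl
  · rw [coe_exteriorPower_map]; rfl

/-- Transport of a system of morphisms along an isomorphism `V → U`. -/
def transport (ψ : AddChar F ℂ) {V U : Symp.{u, v} F} (f : Iso V U)
    (T : ∀ M L : OLag V, model ψ L →ₗ[ℂ] model ψ M) (M L : OLag U) : model ψ L →ₗ[ℂ] model ψ M :=
  modelPullback ψ f.symm M (M.map f.symm) (M.mem_map f.symm) ∘ₗ
    T (M.map f.symm) (L.map f.symm) ∘ₗ
    modelPullback ψ f (L.map f.symm) L (L.mem_of_mem_map_symm f)

theorem transport_isCanonical (ψ : AddChar F ℂ) {V U : Symp.{u, v} F} (f : Iso V U)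
    {T : ∀ M L : OLag V, model ψ L →ₗ[ℂ] model ψ M} (hT : IsCanonical ψ T) :
    IsCanonical ψ (transport ψ f T) := by
  refine ⟨⟨fun M L => ?_, fun M L h x => ?_, fun N M L => LinearMap.ext fun x => ?_⟩,
    fun M L hML x h => ?_⟩
  · exact (modelPullback_bijective ψ f.symm M (M.map f.symm) (M.mem_map f.symm)
      (M.mem_of_mem_map_symm f)).comp ((hT.bijective _ _).comp
        (modelPullback_bijective ψ f (L.map f.symm) L (L.mem_of_mem_map_symm f)
          (L.mem_map f.symm)))
  · have i1 := modelPullback_heisRep ψ f (L.map f.symm) L (L.mem_of_mem_map_symm f)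
      (Heis.map f.symm h) x
    rw [Heis.map_map_symm] at i1
    refine (congrArg (fun t => modelPullback ψ f.symm M (M.map f.symm) (M.mem_map f.symm)
      (T (M.map f.symm) (L.map f.symm) t)) i1).trans ?_
    refine (congrArg _ (hT.intertwines _ _ _ _)).trans ?_
    exact modelPullback_heisRep ψ f.symm M _ _ h _
  · refine (congrArg (fun t => modelPullback ψ f.symm N (N.map f.symm) (N.mem_map f.symm)
      (T (N.map f.symm) (M.map f.symm) t)) (modelPullback_symm ψ f _ _ _ (M.mem_map f.symm) _)).trans ?_
    exact congrArg _ (LinearMap.congr_fun (hT.mul _ _ _) _)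
  · have hs : (L.map f.symm).space ⊔ (M.map f.symm).space = ⊤ := by
      change L.space.map _ ⊔ M.space.map _ = ⊤
      rw [← Submodule.map_sup, hML]
      exact Submodule.map_top _ |>.trans (LinearEquiv.range _)
    have := hT.apply_of_sup_eq_top _ _ hs
      (modelPullback ψ f (L.map f.symm) L (L.mem_of_mem_map_symm f) x) (Heis.map f.symm h)
    rw [normConst_map] at this
    refine this.trans ?_
    congr 1
    refine (finsum_comp_equiv (f.symm.toEquiv.submoduleMap M.space).toEquiv).symm.trans ?_
    refine finsum_congr fun m => congrArg x.1 ?_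
    rw [map_mul, Heis.map_map_symm, Heis.map_ofVec]
    congr 2
    exact f.toEquiv.apply_symm_apply m

/-- The linear map `ℋ(f) : ℋ(U) → ℋ(V)` induced by a morphism `f : V → U`, given by
`(ℋ(f) s)_{L°}(v, z) = s_{f(L°)}(f v, z)`. -/
def canonicalSpaceMap (ψ : AddChar F ℂ) {V U : Symp.{u, v} F} (f : Iso V U) :
    canonicalSpace ψ U →ₗ[ℂ] canonicalSpace ψ V where
  toFun s := ⟨fun L => modelPullback ψ f L (L.map f) (L.mem_map f) (s.1 (L.map f)), by
    intro T hT M L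
    have h := s.2 _ (transport_isCanonical ψ f hT) (M.map f) (L.map f)
    have aux : ∀ (M' L' : OLag V) (_ : M' = M) (_ : L' = L) (x : model ψ L') (y : model ψ L)
        (_ : x.1 = y.1), (T M' L' x).1 = (T M L y).1 := by
      intro M' L' hM hL x y hxy
      subst hM hL
      rw [Subtype.ext hxy]
    refine Subtype.ext (funext fun a => ?_)
    have h2 := congrFun (congrArg Subtype.val h) (Heis.map f a)
    refine Eq.trans ?_ h2
    refine (congrFun (aux _ _ (OLag.map_symm_map f M) (OLag.map_symm_map f L)
      (modelPullback ψ f ((L.map f).map f.symm) (L.map f) ((L.map f).mem_of_mem_map_symm f)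
        (s.1 (L.map f))) (modelPullback ψ f L (L.map f) (L.mem_map f) (s.1 (L.map f))) rfl)
      a).symm.trans ?_
    exact congrArg (T _ _ _).1 (Heis.map_symm_map f a).symm⟩
  map_add' _ _ := rfl
  map_smul' _ _ := rfl

end Canonical

end Symp

end

noncomputable section

namespace Symp

section

variable {F : Type v} [Field F]

/-! ### Common transversals -/

/-! For a Lagrangian `L`, functions `f` in the model for `V̄` and `g` in the model for `V` are
paired by `∑ f(w,0) g(w,0)` over `w ∈ V`. For transversal `L` and `M`, averaging both arguments over
`M` multiplies this sum by `|M| = q^n` (`modelPairing_avg_avg`). Replacing `ω` by `-ω` changes the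
sign inside `σ` by `(-1)^n`, and `G₁² = σ(-1) q`, so the two normalizing constants multiply to
`q^{-n}` (`normConst_dual_mul`). Hence canonical morphisms between transversal models preserve the
pairing. Any two Lagrangians have a common transversal, so the pairing of horizontal sections does
not depend on where it is computed (`pairingAt_eq`). Naturality is then a reindexing of the sum by
`f : V → U`, and non-degeneracy comes from pairing a function with its complex conjugate.

Non-degeneracy also needs every vector of a model to extend to a unique horizontal section. As
horizontality is tested against all canonical systems, this requires their existence and uniqueness.
Existence (`exists_isCanonical`) defines `T_{M,L}` through an auxiliary Lagrangian transversal to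
both. The composition through `M` of two averages from `L` to `N` is a multiple of the direct
average, the factor being `|N ∩ L|⁻¹` times the Gauss sum of `n ↦ ω(p n, n)`, with `p : N → L` the
projection along `M` (`card_smul_avg_avg`). Changing `M` multiplies both this Gauss sum and the
product of the constants by the same sign, the quadratic character of a determinant
(`normAvg_normAvg_eq`). Multiplicativity uses a common transversal of three Lagrangians, which is
found in odd characteristic by a maximality argument. -/

/-- Over a field of characteristic different from two, a subspace which is contained in none of
three given subspaces is not contained in their union. -/
theorem exists_mem_notMem_of_not_le (h2 : (2 : F) ≠ 0) {W : Type*} [AddCommGroup W] [Module F W]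
    {B U₁ U₂ U₃ : Submodule F W} (h₁ : ¬ B ≤ U₁) (h₂ : ¬ B ≤ U₂) (h₃ : ¬ B ≤ U₃) :
    ∃ w ∈ B, w ∉ U₁ ∧ w ∉ U₂ ∧ w ∉ U₃ := by
  -- An affine line with direction outside `U` meets `U` at most once.
  have key : ∀ (U : Submodule F W) (x y : W) (c d : F), x ∉ U → c ≠ d → y + c • x ∈ U →
      y + d • x ∉ U := by
    intro U x y c d hx hcd hc hd
    have h := U.sub_mem hc hd
    rw [add_sub_add_left_eq_sub, ← sub_smul] at h
    exact hx ((U.smul_mem_iff (sub_ne_zero.2 hcd)).1 h)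
  have keep : ∀ (U : Submodule F W) (x y : W) (c : F), x ∈ U → y ∉ U → y + c • x ∉ U :=
    fun U x y c hx hy h => hy ((U.add_mem_iff_left (U.smul_mem c hx)).1 h)
  have two : ∃ w ∈ B, w ∉ U₁ ∧ w ∉ U₂ := by
    obtain ⟨x, hxB, hx⟩ := SetLike.not_le_iff_exists.1 h₁
    obtain ⟨y, hyB, hy⟩ := SetLike.not_le_iff_exists.1 h₂
    by_cases hx2 : x ∈ U₂
    · by_cases hy1 : y + (0 : F) • x ∈ U₁
      · exact ⟨_, B.add_mem hyB (B.smul_mem 1 hxB), key U₁ x y 0 1 hx zero_ne_one hy1,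
          keep U₂ x y 1 hx2 hy⟩
      · exact ⟨_, B.add_mem hyB (B.smul_mem 0 hxB), hy1, keep U₂ x y 0 hx2 hy⟩
    · exact ⟨x, hxB, hx, hx2⟩
  obtain ⟨x, hxB, hx1, hx2⟩ := two
  obtain ⟨y, hyB, hy⟩ := SetLike.not_le_iff_exists.1 h₃
  -- If `x ∈ U₃`, the line `y + F x` avoids `U₃` entirely and meets `U₁` and `U₂` at most once each,
  -- so one of the three distinct parameters `0, 1, -1` survives.
  by_cases hx3 : x ∈ U₃
  · have h3 := fun c => keep U₃ x y c hx3 hy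
    have hB := fun c : F => B.add_mem hyB (B.smul_mem c hxB)
    have e1 : (0 : F) ≠ 1 := zero_ne_one
    have e2 : (0 : F) ≠ -1 := by simp
    have e3 : (1 : F) ≠ -1 := fun h => h2 (by linear_combination h)
    by_cases a0 : y + (0 : F) • x ∈ U₁
    · by_cases b1 : y + (1 : F) • x ∈ U₂
      · exact ⟨_, hB (-1), key U₁ x y _ _ hx1 e2 a0, key U₂ x y _ _ hx2 e3 b1, h3 _⟩
      · exact ⟨_, hB 1, key U₁ x y _ _ hx1 e1 a0, b1, h3 _⟩
    · by_cases b0 : y + (0 : F) • x ∈ U₂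
      · by_cases a1 : y + (1 : F) • x ∈ U₁
        · exact ⟨_, hB (-1), key U₁ x y _ _ hx1 e3 a1, key U₂ x y _ _ hx2 e2 b0, h3 _⟩
        · exact ⟨_, hB 1, a1, key U₂ x y _ _ hx2 e1 b0, h3 _⟩
      · exact ⟨_, hB 0, a0, b0, h3 _⟩
  · exact ⟨x, hxB, hx1, hx2, hx3⟩

variable (V : Symp.{u, v} F)

theorem orthogonal_sup (A B : Submodule F V) :
    V.form.orthogonal (A ⊔ B) = V.form.orthogonal A ⊓ V.form.orthogonal B := by
  apply le_antisymm
  · exact le_inf (LinearMap.BilinForm.orthogonal_le le_sup_left)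
      (LinearMap.BilinForm.orthogonal_le le_sup_right)
  · rintro x ⟨ha, hb⟩ y hy
    obtain ⟨a, haA, b, hbB, rfl⟩ := Submodule.mem_sup.1 hy
    have h1 := ha a haA
    have h2 := hb b hbB
    rw [map_add, LinearMap.add_apply, h1, h2, add_zero]

theorem orthogonal_orthogonal (A : Submodule F V) :
    V.form.orthogonal (V.form.orthogonal A) = A :=
  LinearMap.BilinForm.orthogonal_orthogonal V.nondegenerate V.isAlt.isRefl A

variable {V}

/-- Orthogonal complementation exchanges sums with intersections and fixes both Lagrangians. -/
theorem sup_eq_top_iff_inf_eq_bot {L M : Submodule F V} (hL : V.form.orthogonal L = L)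
    (hM : V.form.orthogonal M = M) : L ⊔ M = ⊤ ↔ L ⊓ M = ⊥ := by
  constructor
  · intro h
    rw [← hL, ← hM, ← orthogonal_sup, h]
    exact LinearMap.BilinForm.orthogonal_top_eq_bot V.nondegenerate
  · intro h
    rw [← orthogonal_orthogonal V (L ⊔ M), orthogonal_sup, hL, hM, h,
      LinearMap.BilinForm.orthogonal_bot]

theorem sup_span_singleton_le_orthogonal {A : Submodule F V} (hA : A ≤ V.form.orthogonal A) {w : V}
    (hw : w ∈ V.form.orthogonal A) : A ⊔ F ∙ w ≤ V.form.orthogonal (A ⊔ F ∙ w) := by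
  rw [orthogonal_sup]
  refine sup_le (le_inf hA ?_) (le_inf ?_ ?_)
  · intro a ha y hy
    obtain ⟨c, rfl⟩ := Submodule.mem_span_singleton.1 hy
    have : V.form w a = 0 := V.isAlt.isRefl _ _ (hw a ha)
    simp [this]
  · rwa [Submodule.span_singleton_le_iff_mem]
  · rw [Submodule.span_singleton_le_iff_mem]
    intro y hy
    obtain ⟨c, rfl⟩ := Submodule.mem_span_singleton.1 hy
    simp [V.isAlt w]

/-- A maximal isotropic subspace works: any `w` orthogonal to it can be adjoined, because `ω(w, w) =
0`. -/
theorem exists_isLagrangian [Finite F] (V : Symp.{u, v} F) :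
    ∃ A : Submodule F V, V.form.orthogonal A = A := by
  have : Finite V := Module.finite_of_finite F
  obtain ⟨A, hiso, hmax⟩ := (Set.toFinite {A : Submodule F V | A ≤ V.form.orthogonal A}).exists_maximal
    ⟨⊥, by simp⟩
  refine ⟨A, le_antisymm (fun w hw => ?_) hiso⟩
  exact hmax (sup_span_singleton_le_orthogonal hiso hw) le_sup_left
    (Submodule.mem_sup_right (Submodule.mem_span_singleton_self w))

/-- Three Lagrangian subspaces over a finite field of odd characteristic have a common
transversal Lagrangian. -/
theorem exists_common_transversal [Finite F] (h2 : (2 : F) ≠ 0) {L₁ L₂ L₃ : Submodule F V}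
    (h₁ : V.form.orthogonal L₁ = L₁) (h₂ : V.form.orthogonal L₂ = L₂)
    (h₃ : V.form.orthogonal L₃ = L₃) :
    ∃ A : Submodule F V, V.form.orthogonal A = A ∧ L₁ ⊔ A = ⊤ ∧ L₂ ⊔ A = ⊤ ∧ L₃ ⊔ A = ⊤ := by
  have : Finite V := Module.finite_of_finite F
  -- Take a maximal isotropic subspace meeting each of the three trivially. If it were not
  -- Lagrangian, a vector of its orthogonal outside all `A ⊔ Lᵢ` could be adjoined.
  let S : Set (Submodule F V) :=
    {A | A ≤ V.form.orthogonal A ∧ L₁ ⊓ A = ⊥ ∧ L₂ ⊓ A = ⊥ ∧ L₃ ⊓ A = ⊥}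
  obtain ⟨A, hA⟩ := (Set.toFinite S).exists_maximal ⟨⊥, by simp [S]⟩
  obtain ⟨⟨hiso, hd₁, hd₂, hd₃⟩, hmax⟩ := hA
  have hAA : V.form.orthogonal A = A := by
    refine le_antisymm ?_ hiso
    by_contra hnot
    -- If `A^⊥ ≤ A + L`, taking orthogonals gives `A^⊥ ∩ L ≤ A`; decomposing `x ∈ A^⊥` as `a + l`
    -- then forces `x ∈ A`.
    have hne : ∀ L : Submodule F V, V.form.orthogonal L = L → L ⊓ A = ⊥ →
        ¬ V.form.orthogonal A ≤ A ⊔ L := by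
      intro L hL hd hle
      have h3 := LinearMap.BilinForm.orthogonal_le (B := V.form) hle
      rw [orthogonal_sup, orthogonal_orthogonal, hL] at h3
      refine hnot fun x hx => ?_
      obtain ⟨a, ha, l, hl, rfl⟩ := Submodule.mem_sup.1 (hle hx)
      have hlA : l ∈ V.form.orthogonal A :=
        ((V.form.orthogonal A).add_mem_iff_right (hiso ha)).1 hx
      exact A.add_mem ha (h3 ⟨hlA, hl⟩)
    obtain ⟨w, hw, n₁, n₂, n₃⟩ := exists_mem_notMem_of_not_le h2 (hne L₁ h₁ hd₁)
      (hne L₂ h₂ hd₂) (hne L₃ h₃ hd₃)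
    have hdis : ∀ L : Submodule F V, L ⊓ A = ⊥ → w ∉ A ⊔ L → L ⊓ (A ⊔ F ∙ w) = ⊥ := by
      intro L hd hn
      rw [eq_bot_iff]
      rintro x ⟨hxL, hx⟩
      obtain ⟨a, ha, y, hy, rfl⟩ := Submodule.mem_sup.1 hx
      obtain ⟨c, rfl⟩ := Submodule.mem_span_singleton.1 hy
      by_cases hc : c = 0
      · subst hc
        rw [zero_smul, add_zero] at hxL ⊢
        exact hd.le ⟨hxL, ha⟩
      · refine absurd ?_ hn
        rw [← (A ⊔ L).smul_mem_iff hc]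
        have := (A ⊔ L).sub_mem (Submodule.mem_sup_right (S := A) hxL)
          (Submodule.mem_sup_left (T := L) ha)
        rwa [add_sub_cancel_left] at this
    have hmem : A ⊔ F ∙ w ∈ S :=
      ⟨sup_span_singleton_le_orthogonal hiso hw, hdis _ hd₁ n₁, hdis _ hd₂ n₂, hdis _ hd₃ n₃⟩
    exact n₁ (Submodule.mem_sup_left (hmax hmem le_sup_left
      (Submodule.mem_sup_right (Submodule.mem_span_singleton_self w))))
  exact ⟨A, hAA, (sup_eq_top_iff_inf_eq_bot h₁ hAA).2 hd₁, (sup_eq_top_iff_inf_eq_bot h₂ hAA).2 hd₂,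
    (sup_eq_top_iff_inf_eq_bot h₃ hAA).2 hd₃⟩

/-! ### Oriented bases -/

/-- The wedge of a basis is an orientation: it is nonzero because its pairing with the wedge of the
dual basis is `1`. -/
theorem exists_olag {L : Submodule F V} (hL : V.form.orthogonal L = L) :
    ∃ M : OLag V, M.space = L := by
  let e := finBasis F L
  have hne : ExteriorAlgebra.ιMulti F (finrank F L) e ≠ 0 := by
    intro h
    have h1 : exteriorPower.ιMulti F (finrank F L) (e : Fin _ → L) = 0 := Subtype.ext h
    have h2 := exteriorPower.pairingDual_ιMulti_ιMulti (fun i => e.coord i) (e : Fin _ → L)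
    rw [h1, map_zero] at h2
    have h3 : (Matrix.of fun i j => (e.coord j) (e i)) = 1 := by
      ext i j
      simp [Matrix.one_apply, Finsupp.single_apply]
    rw [h3, Matrix.det_one] at h2
    exact zero_ne_one h2
  refine ⟨⟨L, hL, ExteriorAlgebra.map L.subtype (ExteriorAlgebra.ιMulti F _ e),
    ⟨_, (exteriorPower.ιMulti F (finrank F L) (e : Fin _ → L)).2, rfl⟩, fun h => hne ?_⟩, rfl⟩
  exact ExteriorAlgebra.map_injective_field L.ker_subtype (h.trans (map_zero _).symm)

/-- The top exterior power of `L` is a line. This presentation turns the normalizing constants into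
determinants of matrices in bases. -/
theorem OLag.exists_orientV_eq (L : OLag V) : ∃ (c : F) (e : Basis (Fin V.halfDim) F L.space),
    c ≠ 0 ∧ L.orientV = c • exteriorPower.ιMulti F V.halfDim (fun i => (e i : V)) := by
  let e : Basis (Fin V.halfDim) F L.space := finBasisOfFinrankEq F L.space L.finrank_space
  have htop : ∀ x : ⋀[F]^V.halfDim L.space,
      ∃ c : F, x = c • exteriorPower.ιMulti F V.halfDim e := by
    intro x
    have hx : x ∈ Submodule.span F (Set.range (exteriorPower.ιMulti F V.halfDim)) := by
      rw [exteriorPower.ιMulti_span]; trivial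
    -- An alternating map in `n` variables on an `n`-dimensional space is `e.det` times its value on
    -- `e`.
    have hf : exteriorPower.ιMulti F V.halfDim (M := L.space)
        = (LinearMap.toSpanSingleton F _ (exteriorPower.ιMulti F V.halfDim e)).compAlternatingMap
          e.det := by
      refine Basis.ext_alternating e fun v hv => ?_
      obtain ⟨σ, rfl⟩ : ∃ σ : Equiv.Perm (Fin V.halfDim), (σ : Fin _ → Fin _) = v :=
        ⟨Equiv.ofBijective v (Finite.injective_iff_bijective.1 hv), rfl⟩
      have h1 := AlternatingMap.map_perm (exteriorPower.ιMulti F V.halfDim (M := L.space)) e σ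
      have h2 := AlternatingMap.map_perm e.det e σ
      simp only [Function.comp_def] at h1 h2
      rw [h1]
      simp [h2, e.det_self]
    rw [hf] at hx
    refine Submodule.span_induction (fun y hy => ?_) ⟨0, by simp⟩ ?_ ?_ hx
    · obtain ⟨w, rfl⟩ := hy
      exact ⟨e.det w, by simp⟩
    · rintro a b - - ⟨c, rfl⟩ ⟨d, rfl⟩
      exact ⟨c + d, by rw [add_smul]⟩
    · rintro r a - ⟨c, rfl⟩
      exact ⟨r * c, by rw [mul_smul]⟩
  obtain ⟨a, ha, h⟩ := L.orient_mem
  rw [L.finrank_space] at ha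
  obtain ⟨c, hc⟩ := htop ⟨a, ha⟩
  have hL : L.orientV = c • exteriorPower.ιMulti F V.halfDim (fun i => (e i : V)) := by
    apply Subtype.ext
    change L.orient = _
    rw [← h]
    have ha' : a = c • (ExteriorAlgebra.ιMulti F V.halfDim e) := congrArg Subtype.val hc
    rw [ha']
    simp [ExteriorAlgebra.map_apply_ιMulti, Function.comp_def]
  refine ⟨c, e, fun h0 => L.orient_ne_zero ?_, hL⟩
  rw [h0, zero_smul] at hL
  exact congrArg Subtype.val hL

/-- A scalar `c` in a chosen presentation `c • (e₁ ∧ … ∧ eₙ)` of the orientation. -/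
def OLag.scale (L : OLag V) : F := L.exists_orientV_eq.choose

/-- A basis `e` in a chosen presentation `c • (e₁ ∧ … ∧ eₙ)` of the orientation. -/
def OLag.basis (L : OLag V) : Basis (Fin V.halfDim) F L.space :=
  L.exists_orientV_eq.choose_spec.choose

theorem OLag.scale_ne_zero (L : OLag V) : L.scale ≠ 0 :=
  L.exists_orientV_eq.choose_spec.choose_spec.1

theorem OLag.orientV_eq (L : OLag V) :
    L.orientV = L.scale • exteriorPower.ιMulti F V.halfDim (fun i => (L.basis i : V)) :=
  L.exists_orientV_eq.choose_spec.choose_spec.2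

/-- The matrix of the symplectic form between the chosen bases of `L` and `M`. -/
def OLag.gram (L M : OLag V) : Matrix (Fin V.halfDim) (Fin V.halfDim) F :=
  Matrix.of fun i j => V.form (L.basis i) (M.basis j)

theorem wedgeForm_orientV (L M : OLag V) :
    V.wedgeForm V.halfDim L.orientV M.orientV
      = (-1) ^ (V.halfDim.choose 2) * (L.scale * M.scale * (L.gram M).det) := by
  rw [wedgeForm, L.orientV_eq, M.orientV_eq]
  simp only [map_smul, LinearMap.smul_apply, exteriorPower.map_apply_ιMulti, smul_eq_mul,
    exteriorPower.pairingDual_ιMulti_ιMulti]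
  -- The determinant formula for `pairingDual` produces the transpose of the Gram matrix.
  rw [← Matrix.det_transpose (OLag.gram L M)]
  simp only [OLag.gram]
  congr 1
  rw [mul_left_comm, ← mul_assoc]
  congr 1

/-- A vector in the left kernel of the matrix gives an element of `L` orthogonal to `M`; it is also
orthogonal to `L`, hence to all of `V`. -/
theorem OLag.gram_det_ne_zero {L M : OLag V} (h : L.space ⊔ M.space = ⊤) :
    (L.gram M).det ≠ 0 := by
  intro h0
  obtain ⟨c, hc, hcG⟩ := Matrix.exists_vecMul_eq_zero_iff.2 h0
  have hx : V.form (∑ i, c i • (L.basis i : V)) = 0 := by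
    apply LinearMap.ext
    intro y
    obtain ⟨l, hl, m, hm, rfl⟩ := Submodule.mem_sup.1 (h ▸ Submodule.mem_top : y ∈ L.space ⊔ M.space)
    have hlL : ∀ i, V.form (L.basis i) l = 0 := fun i => by
      have : l ∈ V.form.orthogonal L.space := L.isLagrangian.symm ▸ hl
      exact this _ (L.basis i).2
    have hmM : m = ∑ j, M.basis.repr ⟨m, hm⟩ j • (M.basis j : V) := by
      have := congrArg M.space.subtype (M.basis.sum_repr ⟨m, hm⟩)
      rw [map_sum] at this
      exact this.symm
    have hG : ∀ j, ∑ i, c i * V.form (L.basis i) (M.basis j) = 0 := fun j => congrFun hcG j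
    rw [map_add, hmM]
    simp only [map_sum, map_smul, LinearMap.sum_apply, LinearMap.smul_apply, smul_eq_mul, hlL,
      mul_zero, Finset.sum_const_zero, zero_add, LinearMap.zero_apply, hG]
  have hx0 : ∑ i, c i • (L.basis i : V) = 0 :=
    V.nondegenerate.1 _ fun y => by rw [hx]; rfl
  have hx1 : ∑ i, c i • L.basis i = 0 := Subtype.ext (by simpa using hx0)
  exact hc (funext (Fintype.linearIndependent_iff.1 L.basis.linearIndependent c hx1))

end

section

variable {F : Type v} [Field F] [Fintype F] [DecidableEq F]

/-! ### Gauss sums of quadratic forms -/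

/-- The quadratic character as a complex number. -/
def sgn (a : F) : ℂ := ((quadraticChar F a : ℤ) : ℂ)

theorem sgn_mul (a b : F) : sgn (a * b) = sgn a * sgn b := by
  rw [sgn, map_mul, Int.cast_mul, sgn, sgn]

theorem sgn_mul_self {a : F} (ha : a ≠ 0) : sgn a * sgn a = 1 := by
  rw [← sgn_mul, ← sq, sgn, quadraticChar_sq_one' ha, Int.cast_one]

theorem sgn_sq_mul {a : F} (ha : a ≠ 0) (b : F) : sgn (a ^ 2 * b) = sgn b := by
  rw [sgn_mul, sq, sgn_mul, sgn_mul_self ha, one_mul]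

theorem sgn_pow (a : F) (k : ℕ) : sgn (a ^ k) = sgn a ^ k := by
  rw [sgn, map_pow, Int.cast_pow, sgn]

theorem sgn_prod {ι : Type*} (s : Finset ι) (a : ι → F) :
    sgn (∏ i ∈ s, a i) = ∏ i ∈ s, sgn (a i) := by simp [sgn, map_prod]

/-- Each `t` has `1 + σ(t)` square roots. The summand `1` contributes nothing since `ψ` is
non-trivial, and the rest is a Gauss sum twisted by `a`. -/
theorem sum_addChar_mul_sq (hF : ringChar F ≠ 2) {ψ : AddChar F ℂ} (hψ : ψ ≠ 1) {a : F}
    (ha : a ≠ 0) : ∑ z : F, ψ (a * z ^ 2)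
      = sgn a * gaussSum ((quadraticChar F).ringHomComp (Int.castRingHom ℂ)) ψ := by
  have h1 : ∑ z : F, ψ (a * z ^ 2) = ∑ t : F, ((quadraticChar F t : ℤ) + 1 : ℂ) * ψ (a * t) := by
    rw [← Finset.sum_fiberwise (g := fun z : F => z ^ 2)]
    refine Finset.sum_congr rfl fun t _ => ?_
    have hc := quadraticChar_card_sqrts hF t
    rw [Finset.sum_congr rfl (g := fun _ => ψ (a * t))
      (fun z hz => by rw [(Finset.mem_filter.1 hz).2]), Finset.sum_const, nsmul_eq_mul]
    congr 1
    have : (Finset.univ.filter fun z : F => z ^ 2 = t) = {x : F | x ^ 2 = t}.toFinset := by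
      ext; simp
    rw [this]
    exact_mod_cast hc
  have h2 : ∑ t : F, ψ (a * t) = 0 := by
    rw [← AddChar.sum_eq_zero_of_ne_one hψ]
    exact Fintype.sum_equiv (Equiv.mulLeft₀ a ha) _ _ fun _ => rfl
  have h3 := gaussSum_mulShift ((quadraticChar F).ringHomComp (Int.castRingHom ℂ)) ψ
    (Units.mk0 a ha)
  rw [h1]
  simp only [add_mul, one_mul, Finset.sum_add_distrib, h2, add_zero]
  rw [← h3, ← mul_assoc]
  have h4 : sgn a * ((quadraticChar F).ringHomComp (Int.castRingHom ℂ)) (Units.mk0 a ha : F) = 1 :=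
    sgn_mul_self ha
  rw [h4, one_mul]
  rfl

/-- Both sums are multiples of the standard Gauss sum, with the factor `sgn 2⁻¹` in common. -/
theorem sum_addChar_half_mul_sq (hF : ringChar F ≠ 2) {ψ : AddChar F ℂ} (hψ : ψ ≠ 1) {d : F}
    (hd : d ≠ 0) : ∑ z : F, ψ (2⁻¹ * (d * z ^ 2)) = sgn d * gaussSumOne ψ := by
  have h2 := inv_ne_zero (Ring.two_ne_zero hF)
  unfold gaussSumOne
  rw [sum_addChar_mul_sq hF hψ h2]
  simp only [← mul_assoc]
  rw [sum_addChar_mul_sq hF hψ (mul_ne_zero h2 hd), sgn_mul]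
  ring

/-- `G₁` is the standard quadratic Gauss sum up to sign. The factor `σ(-1)` later cancels every sign
that comes from the antisymmetry of `ω`. -/
theorem gaussSumOne_sq (hF : ringChar F ≠ 2) {ψ : AddChar F ℂ} (hψ : ψ ≠ 1) :
    gaussSumOne ψ ^ 2 = sgn (-1 : F) * Fintype.card F := by
  have h2 := inv_ne_zero (Ring.two_ne_zero hF)
  unfold gaussSumOne
  rw [sum_addChar_mul_sq hF hψ h2, mul_pow, sq, sgn_mul_self h2, one_mul]
  refine gaussSum_sq ?_ ?_ (AddChar.IsPrimitive.of_ne_one hψ)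
  · exact (MulChar.ringHomComp_ne_one_iff (RingHom.injective_int _)).2 (quadraticChar_ne_one hF)
  · exact (quadraticChar_isQuadratic F).comp _

variable {W : Type*} [AddCommGroup W] [Module F W] [Fintype W]

omit [Fintype F] [DecidableEq F] in
theorem addChar_sum (ψ : AddChar F ℂ) {ι : Type*} (s : Finset ι) (f : ι → F) :
    ψ (∑ i ∈ s, f i) = ∏ i ∈ s, ψ (f i) :=
  map_prod ψ.toMonoidHom (fun i => Multiplicative.ofAdd (f i)) s

/-- The Gauss sum of a nondegenerate symmetric bilinear form. -/
theorem sum_addChar_bilinForm (hF : ringChar F ≠ 2) {ψ : AddChar F ℂ} (hψ : ψ ≠ 1) {n : ℕ}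
    (e : Basis (Fin n) F W) (b : LinearMap.BilinForm F W) (hb : b.IsSymm)
    (hnd : b.Nondegenerate) :
    ∑ w, ψ (2⁻¹ * b w w) = gaussSumOne ψ ^ n * sgn (LinearMap.BilinForm.toMatrix e b).det := by
  have : Module.Finite F W := Module.Finite.of_basis e
  have hn : finrank F W = n := by simpa using finrank_eq_card_basis e
  subst hn
  let := invertibleOfNonzero (Ring.two_ne_zero hF)
  -- In an orthogonal basis the sum factors into one-dimensional Gauss sums. The change of basis
  -- multiplies the discriminant by a nonzero square, which `σ` ignores.
  obtain ⟨o, ho⟩ := LinearMap.BilinForm.exists_orthogonal_basis (LinearMap.BilinForm.isSymm_iff.1 hb)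
  have hdet : sgn (LinearMap.BilinForm.toMatrix e b).det
      = sgn (LinearMap.BilinForm.toMatrix o b).det := by
    rw [← LinearMap.BilinForm.toMatrix_mul_basis_toMatrix o e b, Matrix.det_mul, Matrix.det_mul,
      Matrix.det_transpose, mul_right_comm]
    have hu : (o.toMatrix e).det ≠ 0 := by
      have := Basis.toMatrix_mul_toMatrix_flip o e
      intro h
      have h' := congrArg Matrix.det this
      rw [Matrix.det_mul, h, zero_mul, Matrix.det_one] at h'
      exact zero_ne_one h'
    rw [← sq, sgn_sq_mul hu]
  have hdiag : LinearMap.BilinForm.toMatrix o b = Matrix.diagonal fun i => b (o i) (o i) := by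
    ext i j
    rw [LinearMap.BilinForm.toMatrix_apply, Matrix.diagonal_apply]
    split_ifs with h
    · rw [h]
    · exact ho h
  have hne : ∀ i, b (o i) (o i) ≠ 0 :=
    fun i => LinearMap.BilinForm.iIsOrtho.not_isOrtho_basis_self_of_nondegenerate ho hnd i
  rw [hdet, hdiag, Matrix.det_diagonal, sgn_prod]
  have hQ : ∀ c : Fin (finrank F W) → F, b (∑ i, c i • o i) (∑ i, c i • o i)
      = ∑ i, b (o i) (o i) * c i ^ 2 := by
    intro c
    simp only [map_sum, LinearMap.sum_apply, map_smul, LinearMap.smul_apply, smul_eq_mul]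
    refine Finset.sum_congr rfl fun i _ => ?_
    rw [Finset.sum_eq_single i]
    · ring
    · intro j _ hj
      have : b (o j) (o i) = 0 := ho hj
      simp [this]
    · simp
  rw [← Fintype.sum_equiv o.equivFun.symm.toEquiv
    (fun c : Fin (finrank F W) → F => ∏ i, ψ (2⁻¹ * (b (o i) (o i) * c i ^ 2))) _ (fun c => ?_)]
  · rw [← Fintype.piFinset_univ, Finset.sum_prod_piFinset (g := fun i z => ψ (2⁻¹ * (b (o i) (o i) * z ^ 2)))]
    simp only [sum_addChar_half_mul_sq hF hψ (hne _), Finset.prod_mul_distrib, Finset.prod_const,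
      Finset.card_univ, Fintype.card_fin]
    ring
  · rw [← addChar_sum, ← Finset.mul_sum, ← hQ]
    simp [Basis.equivFun_symm_apply]

/-- Twisting a nondegenerate symmetric form by an endomorphism multiplies the Gauss sum by the
quadratic character of the determinant. -/
theorem sum_addChar_bilinForm_comp_left (hF : ringChar F ≠ 2) {ψ : AddChar F ℂ} (hψ : ψ ≠ 1)
    (b : LinearMap.BilinForm F W) (hb : b.IsSymm) (hnd : b.Nondegenerate)
    (a : W ≃ₗ[F] W) (ha : ∀ x y, b (a x) y = b (a y) x) :
    ∑ w, ψ (2⁻¹ * b (a w) w) = sgn (LinearMap.det (a : W →ₗ[F] W)) * ∑ w, ψ (2⁻¹ * b w w) := by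
  have : Module.Finite F W := Module.Finite.of_finite
  let e := finBasis F W
  -- The twisted form is symmetric by `ha`, and its discriminant is `det a` times that of `b`.
  let b' : LinearMap.BilinForm F W := b.compLeft (a : W →ₗ[F] W)
  have hnd' : b'.Nondegenerate := by
    refine ⟨fun x hx => ?_, fun y hy => ?_⟩
    · exact a.map_eq_zero_iff.1 (hnd.1 _ hx)
    · refine hnd.2 y fun x => ?_
      have := hy (a.symm x)
      simpa [b'] using this
  have h := sum_addChar_bilinForm hF hψ e b' ⟨fun x y => ha x y⟩ hnd'
  rw [LinearMap.BilinForm.toMatrix_compLeft, Matrix.det_mul, Matrix.det_transpose, sgn_mul,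
    LinearMap.det_toMatrix] at h
  rw [sum_addChar_bilinForm hF hψ e b hb hnd]
  refine h.trans ?_
  ring

omit [Fintype F] [DecidableEq F] in
/-- Summation along a linear map of a function which is supported on the range. -/
theorem sum_comp_linearMap {W' : Type*} [AddCommGroup W'] [Module F W'] [Fintype W']
    (q : W →ₗ[F] W') (g : W' → ℂ) (hg : ∀ x, x ∉ LinearMap.range q → g x = 0) :
    ∑ w, g (q w) = Nat.card (LinearMap.ker q) * ∑ x, g x := by
  classical
  rw [← Finset.sum_fiberwise (g := q), Finset.mul_sum]
  refine Finset.sum_congr rfl fun x _ => ?_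
  by_cases hx : x ∈ LinearMap.range q
  · obtain ⟨w, rfl⟩ := hx
    rw [Finset.sum_congr rfl (g := fun _ => g (q w))
        (fun z hz => by rw [(Finset.mem_filter.1 hz).2]), Finset.sum_const, nsmul_eq_mul]
    congr 2
    rw [← Fintype.card_coe, ← Nat.card_eq_fintype_card]
    refine Nat.card_congr ⟨fun z => ⟨z.1 - w, ?_⟩, fun i => ⟨i.1 + w, ?_⟩, ?_, ?_⟩
    · rw [LinearMap.mem_ker, map_sub, (Finset.mem_filter.1 z.2).2, sub_self]
    · simp
    · intro z; simp
    · intro i; simp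
  · rw [hg x hx, mul_zero]
    exact Finset.sum_eq_zero fun z hz => absurd ⟨z, (Finset.mem_filter.1 hz).2⟩ hx

/-- The twisting formula for a possibly degenerate form, when the endomorphism is the identity on
the radical. -/
theorem sum_addChar_bilinForm_comp_left_of_ker (hF : ringChar F ≠ 2) {ψ : AddChar F ℂ}
    (hψ : ψ ≠ 1) (b : LinearMap.BilinForm F W) (hb : b.IsSymm) (a : W ≃ₗ[F] W)
    (ha : ∀ x y, b (a x) y = b (a y) x) (hker : ∀ x ∈ LinearMap.ker b, a x = x) :
    ∑ w, ψ (2⁻¹ * b (a w) w) = sgn (LinearMap.det (a : W →ₗ[F] W)) * ∑ w, ψ (2⁻¹ * b w w) := by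
  classical
  have : Module.Finite F W := Module.Finite.of_finite
  -- Both sums descend to the quotient by the radical, with the same factor `|I|`. Since `a` is the
  -- identity on `I`, its determinant agrees with that of the induced map.
  let I := LinearMap.ker b
  have hI : ∀ x ∈ I, ∀ y, b x y = 0 := fun x hx y => by
    rw [LinearMap.mem_ker.1 hx]; rfl
  have hI' : ∀ x ∈ I, ∀ y, b y x = 0 := fun x hx y => by rw [hb.eq, hI x hx]
  let : Fintype (W ⧸ I) := Fintype.ofFinite _
  let bq : LinearMap.BilinForm F (W ⧸ I) :=
    I.liftQ (LinearMap.flip (I.liftQ b.flip fun x hx => by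
      ext y; exact hI' x hx y)) fun x hx => by
        ext y
        exact hI x hx y
  have hbq : ∀ x y, bq (Submodule.Quotient.mk x) (Submodule.Quotient.mk y) = b x y :=
    fun x y => rfl
  have hmap : I ≤ I.comap (a : W →ₗ[F] W) := fun x hx => by
    change a x ∈ I
    rwa [hker x hx]
  have hmapeq : I.map (a : W →ₗ[F] W) = I := by
    ext x
    constructor
    · rintro ⟨y, hy, rfl⟩
      exact hmap hy
    · exact fun hx => ⟨x, hx, hker x hx⟩
  let aq : (W ⧸ I) ≃ₗ[F] (W ⧸ I) := Submodule.Quotient.equiv I I a hmapeq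
  have haq : ∀ x, aq (Submodule.Quotient.mk x) = Submodule.Quotient.mk (a x) := fun x => rfl
  have hdet : LinearMap.det (a : W →ₗ[F] W) = LinearMap.det (aq : (W ⧸ I) →ₗ[F] (W ⧸ I)) := by
    rw [LinearMap.det_eq_det_mul_det I (a : W →ₗ[F] W) hmap]
    have h1 : (a : W →ₗ[F] W).restrict hmap = LinearMap.id := by
      ext x; exact hker x.1 x.2
    rw [h1, LinearMap.det_id, one_mul]
    congr 1
  have hnd : bq.Nondegenerate := by
    have hl : ∀ x, (∀ y, bq x y = 0) → x = 0 := by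
      intro x hx
      obtain ⟨w, rfl⟩ := Submodule.Quotient.mk_surjective I x
      rw [Submodule.Quotient.mk_eq_zero]
      exact LinearMap.ext fun y => hx (Submodule.Quotient.mk y)
    refine ⟨hl, fun y hy => hl y fun x => ?_⟩
    obtain ⟨w, rfl⟩ := Submodule.Quotient.mk_surjective I x
    obtain ⟨z, rfl⟩ := Submodule.Quotient.mk_surjective I y
    have := hy (Submodule.Quotient.mk w)
    rw [hbq] at this ⊢
    rwa [hb.eq]
  have key := sum_addChar_bilinForm_comp_left hF hψ bq ⟨fun x y => by
      obtain ⟨w, rfl⟩ := Submodule.Quotient.mk_surjective I x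
      obtain ⟨z, rfl⟩ := Submodule.Quotient.mk_surjective I y
      exact hb.eq w z⟩ hnd aq (fun x y => by
      obtain ⟨w, rfl⟩ := Submodule.Quotient.mk_surjective I x
      obtain ⟨z, rfl⟩ := Submodule.Quotient.mk_surjective I y
      exact ha w z)
  have e1 := sum_comp_linearMap I.mkQ (fun x => ψ (2⁻¹ * bq (aq x) x)) (by simp)
  have e2 := sum_comp_linearMap I.mkQ (fun x => ψ (2⁻¹ * bq x x)) (by simp)
  rw [key] at e1
  rw [hdet]
  refine e1.trans ?_
  rw [mul_left_comm, ← e2]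
  rfl

end

section

variable {F : Type v} [Field F]

/-! ### Averaging operators between models -/

instance finite_coe [Finite F] (V : Symp.{u, v} F) : Finite V := Module.finite_of_finite F

instance fintypeCoe [Finite F] (V : Symp.{u, v} F) : Fintype V := Fintype.ofFinite _

instance fintypeSubmodule [Finite F] {V : Symp.{u, v} F} (L : Submodule F V) : Fintype L :=
  Fintype.ofFinite _

variable {V : Symp.{u, v} F} {ψ : AddChar F ℂ}

theorem form_eq_neg (x y : V) : V.form x y = -V.form y x := (V.isAlt.neg_eq y x).symm

theorem OLag.form_eq_zero (L : OLag V) {x y : V} (hx : x ∈ L.space) (hy : y ∈ L.space) :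
    V.form x y = 0 := by
  have h : y ∈ V.form.orthogonal L.space := L.isLagrangian.symm ▸ hy
  exact h x hx

theorem OLag.mem_of_forall_form_eq_zero (L : OLag V) {x : V}
    (h : ∀ y ∈ L.space, V.form x y = 0) : x ∈ L.space := by
  rw [← L.isLagrangian]
  exact fun y hy => V.isAlt.isRefl _ _ (h y hy)

theorem Heis.ofVec_mul_ofVec_mul (a b : V) (h : Heis V) : Heis.ofVec a * (Heis.ofVec b * h)
    = Heis.ofCen (2⁻¹ * V.form a b) * (Heis.ofVec (a + b) * h) := by
  rw [← mul_assoc, ← mul_assoc]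
  congr 1
  ext <;> simp

theorem model_ofVec_mul_ofVec_mul {L : OLag V} (f : model ψ L) (a b : V) (h : Heis V) :
    f.1 (Heis.ofVec a * (Heis.ofVec b * h))
      = ψ (2⁻¹ * V.form a b) * f.1 (Heis.ofVec (a + b) * h) := by
  rw [Heis.ofVec_mul_ofVec_mul, f.2.1]

/-- In the Heisenberg group, `(l + a, 0) = (0, -½ω(l, a)) · (l, 0) · (a, 0)`. -/
theorem model_ofVec_add_mul {L : OLag V} (f : model ψ L) {l : V} (hl : l ∈ L.space) (a : V)
    (h : Heis V) : f.1 (Heis.ofVec (l + a) * h)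
      = ψ (-(2⁻¹ * V.form l a)) * f.1 (Heis.ofVec a * h) := by
  have h1 := f.2.2 l hl (Heis.ofVec a * h)
  rw [model_ofVec_mul_ofVec_mul] at h1
  rw [← h1, ← mul_assoc, ← AddChar.map_add_eq_mul, neg_add_cancel, AddChar.map_zero_eq_one, one_mul]

theorem Heis.ofCen_mul_comm (z : F) (a : Heis V) : Heis.ofCen z * a = a * Heis.ofCen z := by
  ext <;> simp [add_comm]

theorem Heis.mul_ofCen_mul (z : F) (a b : Heis V) :
    a * (Heis.ofCen z * b) = Heis.ofCen z * (a * b) := by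
  rw [← mul_assoc, ← Heis.ofCen_mul_comm, mul_assoc]

/-- The operator `f ↦ ∑_{m ∈ M} f(m · h)` from `ℋ_{L°}` to `ℋ_{M°}`. -/
def avg [Finite F] (ψ : AddChar F ℂ) (M L : OLag V) : model ψ L →ₗ[ℂ] model ψ M where
  toFun f := ⟨fun h => ∑ m : M.space, f.1 (Heis.ofVec (m : V) * h),
    fun z h => by
      simp only [Heis.mul_ofCen_mul, f.2.1, Finset.mul_sum],
    fun l hl h => by
      refine Fintype.sum_equiv (Equiv.addRight (⟨l, hl⟩ : M.space)) _ _ fun m => ?_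
      rw [model_ofVec_mul_ofVec_mul, M.form_eq_zero m.2 hl, mul_zero, AddChar.map_zero_eq_one,
        one_mul]
      rfl⟩
  map_add' f g := Subtype.ext (funext fun h => Finset.sum_add_distrib)
  map_smul' c f := Subtype.ext (funext fun h => (Finset.mul_sum _ _ _).symm)

theorem avg_apply [Finite F] (M L : OLag V) (f : model ψ L) (h : Heis V) :
    (avg ψ M L f).1 h = ∑ m : M.space, f.1 (Heis.ofVec (m : V) * h) := rfl

theorem avg_heisRep [Finite F] (M L : OLag V) (h : Heis V) (f : model ψ L) :
    avg ψ M L (heisRep ψ L h f) = heisRep ψ M h (avg ψ M L f) :=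
  Subtype.ext (funext fun a => Finset.sum_congr rfl fun m _ =>
    congrArg f.1 (mul_assoc (Heis.ofVec (m : V)) a h))

/-! ### Projections along a Lagrangian and their quadratic forms -/

/-- `p : N → L` is the projection along `M`. -/
def IsProjAlong (M : OLag V) {N L : OLag V} (p : N.space ≃ₗ[F] L.space) : Prop :=
  ∀ n : N.space, (n : V) - p n ∈ M.space

/-- The projection is injective on `N` because `N ∩ M = 0`, and both spaces have dimension `n`. -/
theorem exists_isProjAlong {L M N : OLag V} (hL : L.space ⊔ M.space = ⊤)
    (hN : N.space ⊔ M.space = ⊤) : ∃ p : N.space ≃ₗ[F] L.space, IsProjAlong M p := by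
  have hdL := (sup_eq_top_iff_inf_eq_bot L.isLagrangian M.isLagrangian).1 hL
  have hdN := (sup_eq_top_iff_inf_eq_bot N.isLagrangian M.isLagrangian).1 hN
  have hc : IsCompl L.space M.space := ⟨disjoint_iff.2 hdL, codisjoint_iff.2 hL⟩
  let p : N.space →ₗ[F] L.space := (Submodule.projectionOnto L.space M.space hc) ∘ₗ
    N.space.subtype
  have hp : ∀ n : N.space, (n : V) - p n ∈ M.space := by
    intro n
    rw [← Submodule.projectionOnto_apply_eq_zero_iff hc, map_sub,
      Submodule.projectionOnto_apply_left]
    exact sub_self _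
  have hinj : Function.Injective p := by
    rw [injective_iff_map_eq_zero]
    intro n hn
    have := hp n
    rw [hn, Submodule.coe_zero, sub_zero] at this
    exact Subtype.ext (hdN.le ⟨n.2, this⟩)
  exact ⟨LinearEquiv.ofInjectiveOfFinrankEq p hinj
    (by rw [N.finrank_space, L.finrank_space]), hp⟩

namespace IsProjAlong

variable {L M N : OLag V} {p : N.space ≃ₗ[F] L.space}

theorem apply_eq (hp : IsProjAlong M p) (hL : L.space ⊔ M.space = ⊤) {n : N.space}
    (hn : (n : V) ∈ L.space) : (p n : V) = n := by
  have hdL := (sup_eq_top_iff_inf_eq_bot L.isLagrangian M.isLagrangian).1 hL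
  have : (n : V) - p n ∈ L.space ⊓ M.space := ⟨L.space.sub_mem hn (p n).2, hp n⟩
  rw [hdL] at this
  exact (sub_eq_zero.1 this).symm

/-- Expand `ω(n - p n, n' - p n') = 0`, which holds as `M` is isotropic; isotropy of `N` and `L`
removes two of the four terms. -/
theorem form_symm (hp : IsProjAlong M p) (n n' : N.space) :
    V.form (p n) n' = V.form (p n') n := by
  have h := M.form_eq_zero (hp n) (hp n')
  simp only [map_sub, LinearMap.sub_apply, N.form_eq_zero n.2 n'.2,
    L.form_eq_zero (p n).2 (p n').2] at h
  rw [form_eq_neg (p n' : V)]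
  linear_combination -h

theorem form_left (hp : IsProjAlong M p) {m : V} (hm : m ∈ M.space) (n : N.space) :
    V.form (p n) m = V.form n m := by
  have h := M.form_eq_zero (hp n) hm
  rw [map_sub, LinearMap.sub_apply, sub_eq_zero] at h
  exact h.symm

theorem form_right (hp : IsProjAlong M p) {m : V} (hm : m ∈ M.space) (n : N.space) :
    V.form m (p n) = V.form m n := by
  rw [form_eq_neg, hp.form_left hm, ← form_eq_neg]

end IsProjAlong

/-- The bilinear form `(n, n') ↦ ω(p n, n')` on `N`. -/
def projForm {N L : OLag V} (p : N.space ≃ₗ[F] L.space) : LinearMap.BilinForm F N.space :=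
  (V.form.compl₁₂ L.space.subtype N.space.subtype).comp (p : N.space →ₗ[F] L.space)

theorem projForm_apply {N L : OLag V} (p : N.space ≃ₗ[F] L.space) (n n' : N.space) :
    projForm p n n' = V.form (p n) n' := rfl

namespace IsProjAlong

variable {L M N : OLag V} {p : N.space ≃ₗ[F] L.space}

/-- If `p n` is orthogonal to `N`, it lies in `N ∩ L`, which `p` fixes pointwise; injectivity then
gives `p n = n`. -/
theorem mem_ker_projForm (hp : IsProjAlong M p) (hL : L.space ⊔ M.space = ⊤) {n : N.space} :
    n ∈ LinearMap.ker (projForm p) ↔ (n : V) ∈ L.space := by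
  constructor
  · intro hn
    have h1 : (p n : V) ∈ N.space := N.mem_of_forall_form_eq_zero fun y hy =>
      LinearMap.congr_fun (LinearMap.mem_ker.1 hn) ⟨y, hy⟩
    have h2 : (p ⟨p n, h1⟩ : V) = p n := hp.apply_eq hL (p n).2
    have h3 : (⟨p n, h1⟩ : N.space) = n := p.injective (Subtype.ext h2)
    rw [← h3]
    exact (p n).2
  · intro hn
    refine LinearMap.ext fun y => ?_
    rw [projForm_apply, hp.apply_eq hL hn, N.form_eq_zero n.2 y.2]
    rfl

/-- The difference `n ↦ n - p n`, as a map to `M`. -/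
def diff (hp : IsProjAlong M p) : N.space →ₗ[F] M.space :=
  (N.space.subtype - L.space.subtype ∘ₗ (p : N.space →ₗ[F] L.space)).codRestrict M.space hp

theorem coe_diff (hp : IsProjAlong M p) (n : N.space) : (hp.diff n : V) = n - p n := rfl

theorem ker_diff (hp : IsProjAlong M p) (hL : L.space ⊔ M.space = ⊤) :
    LinearMap.ker hp.diff = L.space.comap N.space.subtype := by
  ext n
  rw [LinearMap.mem_ker, ← Submodule.coe_eq_zero, coe_diff, sub_eq_zero, Submodule.mem_comap]
  exact ⟨fun h => by rw [Submodule.subtype_apply, h]; exact (p n).2,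
    fun h => (hp.apply_eq hL h).symm⟩

/-- The range of `n ↦ n - p n` is `M ∩ (N + L)`, and `N + L` is the orthogonal of `N ∩ L`. -/
theorem exists_form_ne_zero (hp : IsProjAlong M p) (hL : L.space ⊔ M.space = ⊤) {m : M.space}
    (hm : m ∉ LinearMap.range hp.diff) :
    ∃ i : N.space, (i : V) ∈ L.space ∧ V.form m i ≠ 0 := by
  by_contra! hcon
  apply hm
  have h1 : (m : V) ∈ N.space ⊔ L.space := by
    rw [← orthogonal_orthogonal V (N.space ⊔ L.space), orthogonal_sup, N.isLagrangian,
      L.isLagrangian]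
    exact fun y hy => V.isAlt.isRefl _ _ (hcon ⟨y, hy.1⟩ hy.2)
  obtain ⟨n, hn, l, hl, hnl⟩ := Submodule.mem_sup.1 h1
  refine ⟨⟨n, hn⟩, Subtype.ext ?_⟩
  have hdL := (sup_eq_top_iff_inf_eq_bot L.isLagrangian M.isLagrangian).1 hL
  have h2 : (m : V) - (hp.diff ⟨n, hn⟩ : V) ∈ L.space ⊓ M.space := by
    refine ⟨?_, M.space.sub_mem m.2 (hp.diff _).2⟩
    rw [coe_diff, ← hnl]
    have : n + l - (n - (p ⟨n, hn⟩ : V)) = l + p ⟨n, hn⟩ := by abel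
    rw [this]
    exact L.space.add_mem hl (p _).2
  rw [hdL] at h2
  exact (sub_eq_zero.1 h2).symm

/-- Translation by a radical vector `i` leaves the quadratic part alone and multiplies the sum by
`ψ(ω(m, i))`, which can be made different from `1`. -/
theorem sum_addChar_eq_zero [Finite F] (hψ : ψ ≠ 1) (hp : IsProjAlong M p)
    (hL : L.space ⊔ M.space = ⊤) {m : M.space} (hm : m ∉ LinearMap.range hp.diff) :
    ∑ n : N.space, ψ (V.form m (p n) + 2⁻¹ * projForm p n n) = 0 := by
  obtain ⟨i, hi, hmi⟩ := hp.exists_form_ne_zero hL hm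
  obtain ⟨c, hc⟩ := AddChar.ne_one_iff.1 hψ
  let t : F := c / V.form m i
  have hti : ((t • i : N.space) : V) ∈ L.space := L.space.smul_mem t hi
  have hker := (hp.mem_ker_projForm hL).2 hti
  have h : ∑ n : N.space, ψ (V.form m (p n) + 2⁻¹ * projForm p n n)
      = ψ c * ∑ n : N.space, ψ (V.form m (p n) + 2⁻¹ * projForm p n n) := by
    rw [Finset.mul_sum]
    refine (Fintype.sum_equiv (Equiv.addRight (t • i)) _ _ fun n => ?_).symm
    rw [← AddChar.map_add_eq_mul, Equiv.coe_addRight]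
    congr 1
    have h1 : projForm p (n + t • i) (n + t • i) = projForm p n n := by
      have h2 : projForm p n (t • i) = projForm p (t • i) n := hp.form_symm n (t • i)
      have h3 : projForm p (t • i) = 0 := hker
      rw [map_add (projForm p), LinearMap.add_apply, map_add, h2, h3]
      simp
    have h4 : (p (n + t • i) : V) = p n + t • (i : V) := by
      rw [map_add, Submodule.coe_add, hp.apply_eq hL hti]; rfl
    rw [h1, h4, map_add, map_smul, smul_eq_mul, div_mul_cancel₀ _ hmi]
    ring
  have h5 : (1 - ψ c) * ∑ n : N.space, ψ (V.form m (p n) + 2⁻¹ * projForm p n n) = 0 := by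
    linear_combination h
  exact (mul_eq_zero.1 h5).resolve_left (sub_ne_zero.2 (Ne.symm hc))

/-- Completing the square: the linear term is `-projForm p n n₀`, so translating by `n₀` absorbs it.
-/
theorem sum_addChar_diff [Finite F] (h2 : (2 : F) ≠ 0) (hp : IsProjAlong M p) (n₀ : N.space) :
    ∑ n : N.space, ψ (V.form (hp.diff n₀ : V) (p n) + 2⁻¹ * projForm p n n)
      = ψ (-(2⁻¹ * projForm p n₀ n₀)) * ∑ n : N.space, ψ (2⁻¹ * projForm p n n) := by
  rw [Finset.mul_sum]
  refine Fintype.sum_equiv (Equiv.subRight n₀) _ _ fun n => ?_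
  rw [← AddChar.map_add_eq_mul, Equiv.subRight_apply]
  congr 1
  have h1 : V.form (hp.diff n₀ : V) (p n) = -projForm p n n₀ := by
    rw [coe_diff, map_sub, LinearMap.sub_apply, L.form_eq_zero (p n₀).2 (p n).2, sub_zero,
      form_eq_neg, projForm_apply]
  have h3 : projForm p n₀ n = projForm p n n₀ := hp.form_symm n₀ n
  rw [h1, map_sub (projForm p), LinearMap.sub_apply, map_sub, map_sub, h3]
  field_simp
  ring

/-- The composition of two averaging operators. -/
theorem card_smul_avg_avg [Finite F] (h2 : (2 : F) ≠ 0) (hψ : ψ ≠ 1) (hp : IsProjAlong M p)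
    (hL : L.space ⊔ M.space = ⊤) (f : model ψ L) :
    (Nat.card (L.space.comap N.space.subtype) : ℂ) • avg ψ N M (avg ψ M L f)
      = (∑ n : N.space, ψ (2⁻¹ * projForm p n n)) • avg ψ N L f := by
  refine Subtype.ext (funext fun h => ?_)
  change _ * ∑ n : N.space, ∑ m : M.space, f.1 (Heis.ofVec (m : V) * (Heis.ofVec (n : V) * h))
    = _ * ∑ n : N.space, f.1 (Heis.ofVec (n : V) * h)
  -- Shifting `m` by `n - p n ∈ M` leaves the `L`-component `p n`, which acts only through a phase.
  have e1 : ∀ n : N.space, ∑ m : M.space, f.1 (Heis.ofVec (m : V) * (Heis.ofVec (n : V) * h))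
      = ∑ m : M.space, ψ (V.form m (p n) + 2⁻¹ * projForm p n n) *
        f.1 (Heis.ofVec (m : V) * h) := by
    intro n
    refine Fintype.sum_equiv (Equiv.addRight (hp.diff n)) _ _ fun m => ?_
    have e2 : ((m : V) + n) = p n + ((m : V) + (hp.diff n : V)) := by rw [coe_diff]; abel
    rw [model_ofVec_mul_ofVec_mul, e2, model_ofVec_add_mul f (p n).2, ← mul_assoc,
      ← AddChar.map_add_eq_mul, Equiv.coe_addRight, Submodule.coe_add]
    congr 2
    have e3 : V.form m n = V.form m (p n) := (hp.form_right m.2 n).symm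
    have e4 : V.form (p n) m = - V.form m (p n) := form_eq_neg _ _
    have e5 : V.form (hp.diff n : V) (p n) = - V.form (p n) n := by
      rw [form_eq_neg, coe_diff, map_sub, V.isAlt, sub_zero]
    have e6 : V.form (p n) (hp.diff n : V) = V.form (p n) n := by
      rw [coe_diff, map_sub, V.isAlt, sub_zero]
    rw [map_add, map_add, LinearMap.add_apply, e3, e4, e5, e6, projForm_apply]
    field_simp
    ring
  simp only [e1]
  rw [Finset.sum_comm]
  simp only [← Finset.sum_mul]
  -- The coefficient of `m` vanishes outside the range of `hp.diff`, so `|N ∩ L|` times the sum over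
  -- `M` is a sum over `N`.
  rw [← hp.ker_diff hL, ← sum_comp_linearMap hp.diff
    (fun m : M.space => (∑ n : N.space, ψ (V.form m (p n) + 2⁻¹ * projForm p n n)) *
        f.1 (Heis.ofVec (m : V) * h))
    (fun m hm => by rw [hp.sum_addChar_eq_zero hψ hL hm, zero_mul]), Finset.mul_sum]
  refine Finset.sum_congr rfl fun n _ => ?_
  have e7 : (hp.diff n : V) = -(p n : V) + n := by rw [coe_diff]; abel
  rw [hp.sum_addChar_diff h2, e7, model_ofVec_add_mul f (L.space.neg_mem (p n).2), mul_right_comm,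
    ← mul_assoc, ← AddChar.map_add_eq_mul]
  -- The phase left by completing the square cancels the one from moving `-p n` out of the argument
  -- of `f`.
  have e8 : -(2⁻¹ * projForm p n n) + -(2⁻¹ * V.form (-(p n : V)) n) = 0 := by
    rw [projForm_apply, map_neg, LinearMap.neg_apply]; ring
  rw [e8, AddChar.map_zero_eq_one, one_mul, mul_comm]

end IsProjAlong

end

section

variable {F : Type v} [Field F] [Fintype F] [DecidableEq F] {V : Symp.{u, v} F} {ψ : AddChar F ℂ}

/-! ### Multiplicativity of the normalized operators -/

/-- The explicit sign `(-1)^(n choose 2)` cancels the one inside `wedgeForm`. -/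
theorem normConst_eq (ψ : AddChar F ℂ) (M L : OLag V) :
    normConst ψ M L = (gaussSumOne ψ / Fintype.card F) ^ V.halfDim *
      sgn (L.scale * M.scale * (L.gram M).det) := by
  rw [normConst, wedgeForm_orientV, ← mul_assoc, ← mul_pow, neg_one_mul, neg_neg, one_pow, one_mul,
    sgn]

/-- The matrix of `p : N → L` in the chosen bases. -/
def projMatrix {N L : OLag V} (p : N.space ≃ₗ[F] L.space) :
    Matrix (Fin V.halfDim) (Fin V.halfDim) F :=
  LinearMap.toMatrix N.basis L.basis (p : N.space →ₗ[F] L.space)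

omit [Fintype F] [DecidableEq F] in
theorem projMatrix_det_ne_zero {N L : OLag V} (p : N.space ≃ₗ[F] L.space) :
    (projMatrix p).det ≠ 0 := by
  have h : projMatrix p * projMatrix p.symm = 1 := by
    rw [projMatrix, projMatrix, ← LinearMap.toMatrix_comp]
    simp
  intro h0
  have h' := congrArg Matrix.det h
  rw [Matrix.det_mul, h0, zero_mul, Matrix.det_one] at h'
  exact zero_ne_one h'

omit [Fintype F] [DecidableEq F] in
theorem coe_proj_basis {N L : OLag V} (p : N.space ≃ₗ[F] L.space) (k : Fin V.halfDim) :
    (p (N.basis k) : V) = ∑ i, projMatrix p i k • (L.basis i : V) := by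
  have h := congrArg L.space.subtype (L.basis.sum_repr (p (N.basis k)))
  rw [map_sum] at h
  refine h.symm.trans (Finset.sum_congr rfl fun i _ => ?_)
  rw [projMatrix, LinearMap.toMatrix_apply]
  rfl

omit [Fintype F] [DecidableEq F] in
theorem IsProjAlong.gram_eq {L M N : OLag V} {p : N.space ≃ₗ[F] L.space} (hp : IsProjAlong M p) :
    N.gram M = (projMatrix p).transpose * L.gram M := by
  ext k j
  rw [Matrix.mul_apply]
  simp only [OLag.gram, Matrix.of_apply, Matrix.transpose_apply]
  -- Pairing with `M` does not see the difference `n - p n`.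
  rw [← hp.form_left (M.basis j).2, coe_proj_basis]
  simp

omit [Fintype F] [DecidableEq F] in
theorem OLag.gram_det_swap (N M : OLag V) :
    (M.gram N).det = (-1) ^ V.halfDim * (N.gram M).det := by
  have h : M.gram N = -(N.gram M).transpose := by
    ext i j
    exact form_eq_neg _ _
  rw [h, Matrix.det_neg, Matrix.det_transpose, Fintype.card_fin]

omit [DecidableEq F] in
theorem card_ne_zero_complex : (Fintype.card F : ℂ) ≠ 0 :=
  Nat.cast_ne_zero.2 Fintype.card_ne_zero

theorem gaussSumOne_div_card_mul_self (hF : ringChar F ≠ 2) (hψ : ψ ≠ 1) :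
    gaussSumOne ψ / Fintype.card F * (gaussSumOne ψ / Fintype.card F)
      = sgn (-1 : F) * (Fintype.card F : ℂ)⁻¹ := by
  have hq := card_ne_zero_complex (F := F)
  have h := gaussSumOne_sq hF hψ
  field_simp
  rw [h, mul_comm]

/-- The scale of `M` and the Gram determinant of `L` and `M` occur squared, so `M` survives only
through `p`. The sign `(-1)^n` from exchanging `M` and `N` is cancelled by `σ(-1)^n` from `G₁^(2n)`.
-/
theorem IsProjAlong.normConst_mul (hF : ringChar F ≠ 2) (hψ : ψ ≠ 1) {L M N : OLag V}
    {p : N.space ≃ₗ[F] L.space} (hp : IsProjAlong M p) (hL : L.space ⊔ M.space = ⊤) :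
    normConst ψ N M * normConst ψ M L = ((Fintype.card F : ℂ)⁻¹) ^ V.halfDim *
      sgn (L.scale * N.scale * (projMatrix p).det) := by
  rw [normConst_eq, normConst_eq, mul_mul_mul_comm, ← mul_pow, gaussSumOne_div_card_mul_self hF hψ,
    ← sgn_mul, OLag.gram_det_swap, hp.gram_eq, Matrix.det_mul, Matrix.det_transpose]
  have h1 : M.scale * N.scale * ((-1) ^ V.halfDim * ((projMatrix p).det * (L.gram M).det)) *
      (L.scale * M.scale * (L.gram M).det) = (M.scale * (L.gram M).det) ^ 2 *
        ((-1) ^ V.halfDim * (L.scale * N.scale * (projMatrix p).det)) := by ring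
  rw [h1, sgn_sq_mul (mul_ne_zero M.scale_ne_zero (OLag.gram_det_ne_zero hL)), sgn_mul, sgn_pow,
    ← mul_assoc, ← mul_pow]
  rw [mul_right_comm (sgn (-1 : F)), sgn_mul_self (by simp), one_mul]

/-- The normalized operator `A_{M°,L°} ∑_{m ∈ M} f(m · h)`. -/
def normAvg (ψ : AddChar F ℂ) (M L : OLag V) : model ψ L →ₗ[ℂ] model ψ M :=
  normConst ψ M L • avg ψ M L

theorem normAvg_apply (M L : OLag V) (f : model ψ L) :
    normAvg ψ M L f = normConst ψ M L • avg ψ M L f := rfl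

omit [DecidableEq F] in
theorem card_comap_ne_zero (N L : OLag V) :
    (Nat.card (L.space.comap N.space.subtype) : ℂ) ≠ 0 :=
  Nat.cast_ne_zero.2 Nat.card_pos.ne'

theorem IsProjAlong.normAvg_normAvg (hF : ringChar F ≠ 2) (hψ : ψ ≠ 1) {L M N : OLag V}
    {p : N.space ≃ₗ[F] L.space} (hp : IsProjAlong M p) (hL : L.space ⊔ M.space = ⊤)
    (f : model ψ L) : normAvg ψ N M (normAvg ψ M L f) =
      (((Fintype.card F : ℂ)⁻¹) ^ V.halfDim *
        (Nat.card (L.space.comap N.space.subtype) : ℂ)⁻¹ *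
        (sgn (L.scale * N.scale * (projMatrix p).det) *
        ∑ n : N.space, ψ (2⁻¹ * projForm p n n))) • avg ψ N L f := by
  have h := hp.card_smul_avg_avg (Ring.two_ne_zero hF) hψ hL f
  rw [← eq_inv_smul_iff₀ (card_comap_ne_zero N L)] at h
  rw [normAvg_apply, normAvg_apply, map_smul, h, smul_smul, smul_smul, smul_smul,
    hp.normConst_mul hF hψ hL]
  congr 1
  ring

/-- The composition of two normalized operators does not depend on the intermediate Lagrangian. -/
theorem normAvg_normAvg_eq (hF : ringChar F ≠ 2) (hψ : ψ ≠ 1) {L N M M' : OLag V}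
    (hL : L.space ⊔ M.space = ⊤) (hN : N.space ⊔ M.space = ⊤) (hL' : L.space ⊔ M'.space = ⊤)
    (hN' : N.space ⊔ M'.space = ⊤) (f : model ψ L) :
    normAvg ψ N M (normAvg ψ M L f) = normAvg ψ N M' (normAvg ψ M' L f) := by
  obtain ⟨p, hp⟩ := exists_isProjAlong hL hN
  obtain ⟨p', hp'⟩ := exists_isProjAlong hL' hN'
  rw [hp.normAvg_normAvg hF hψ hL, hp'.normAvg_normAvg hF hψ hL']
  congr 2
  -- Replacing `p` by `p' = p ∘ a` twists the form by `a`, which is the identity on its radical `N ∩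
  -- L`. The Gauss sum and the constant both change by `sgn (det a)`, and the two signs cancel.
  let a : N.space ≃ₗ[F] N.space := p'.trans p.symm
  have hpa : ∀ n, p (a n) = p' n := fun n => p.apply_symm_apply _
  have key := sum_addChar_bilinForm_comp_left_of_ker hF hψ (projForm p)
    ⟨fun x y => hp.form_symm x y⟩ a (fun x y => by
      simp only [projForm_apply, hpa]
      exact hp'.form_symm x y) (fun x hx => by
      apply p.injective
      rw [hpa]
      have hx' := (hp.mem_ker_projForm hL).1 hx
      exact Subtype.ext ((hp'.apply_eq hL' hx').trans (hp.apply_eq hL hx').symm))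
  simp only [projForm_apply, hpa] at key
  have hdet : (projMatrix p').det
      = (projMatrix p).det * LinearMap.det (a : N.space →ₗ[F] N.space) := by
    have : (p' : N.space →ₗ[F] L.space)
        = (p : N.space →ₗ[F] L.space) ∘ₗ (a : N.space →ₗ[F] N.space) := by
      ext n
      exact congrArg Subtype.val (hpa n).symm
    rw [projMatrix, this, LinearMap.toMatrix_comp N.basis N.basis L.basis, Matrix.det_mul,
      LinearMap.det_toMatrix]
    rfl
  have hda : LinearMap.det (a : N.space →ₗ[F] N.space) ≠ 0 := (LinearEquiv.isUnit_det' a).ne_zero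
  simp only [projForm_apply]
  rw [key, hdet, ← mul_assoc (L.scale * N.scale), sgn_mul _ (LinearMap.det _), mul_assoc (sgn _),
    ← mul_assoc (sgn (LinearMap.det _)), sgn_mul_self hda, one_mul]

/-- The normalized operators are multiplicative on triples in general position. -/
theorem normAvg_normAvg_of_sup_eq_top (hF : ringChar F ≠ 2) (hψ : ψ ≠ 1) {L M N : OLag V}
    (hL : L.space ⊔ M.space = ⊤) (hN : N.space ⊔ M.space = ⊤) (hLN : L.space ⊔ N.space = ⊤)
    (f : model ψ L) : normAvg ψ N M (normAvg ψ M L f) = normAvg ψ N L f := by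
  obtain ⟨p, hp⟩ := exists_isProjAlong hL hN
  rw [hp.normAvg_normAvg hF hψ hL, normAvg_apply]
  congr 1
  have hinf := (sup_eq_top_iff_inf_eq_bot L.isLagrangian N.isLagrangian).1 hLN
  have hcomap : L.space.comap N.space.subtype = ⊥ := by
    rw [eq_bot_iff]
    intro n hn
    exact Subtype.ext (hinf.le ⟨hn, n.2⟩)
  have hker : ∀ n, n ∈ LinearMap.ker (projForm p) → n = 0 := fun n hn => by
    have := (hp.mem_ker_projForm hL).1 hn
    exact Subtype.ext (hinf.le ⟨this, n.2⟩)
  have hsymm : ∀ x y, projForm p x y = projForm p y x := fun x y => hp.form_symm x y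
  have hnd : (projForm p).Nondegenerate :=
    ⟨fun x hx => hker x (LinearMap.ext hx),
      fun y hy => hker y (LinearMap.ext fun x => (hsymm y x).trans (hy x))⟩
  -- The radical is trivial here, so the Gauss sum is `G₁^n` times a sign. Its discriminant contains
  -- a second factor `det p`, which makes a square with the one in the constants.
  have hmat : LinearMap.BilinForm.toMatrix N.basis (projForm p)
      = (projMatrix p).transpose * L.gram N := by
    ext k j
    rw [Matrix.mul_apply, LinearMap.BilinForm.toMatrix_apply, projForm_apply, coe_proj_basis]
    simp [OLag.gram]
  rw [hcomap, Nat.card_unique, Nat.cast_one, inv_one, mul_one,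
    sum_addChar_bilinForm hF hψ N.basis _ ⟨hsymm⟩ hnd, hmat, Matrix.det_mul,
    Matrix.det_transpose, normConst_eq, div_eq_mul_inv, mul_pow]
  have h1 : L.scale * N.scale * (projMatrix p).det * ((projMatrix p).det * (L.gram N).det)
      = (projMatrix p).det ^ 2 * (L.scale * N.scale * (L.gram N).det) := by ring
  have h2 := sgn_sq_mul (projMatrix_det_ne_zero p) (L.scale * N.scale * (L.gram N).det)
  rw [← h1, sgn_mul] at h2
  rw [← h2]
  ring

/-- The normalized operators between transversal Lagrangians are inverse to each other. -/
theorem normAvg_normAvg_self (hF : ringChar F ≠ 2) (hψ : ψ ≠ 1) {L M : OLag V}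
    (hL : L.space ⊔ M.space = ⊤) (f : model ψ L) :
    normAvg ψ L M (normAvg ψ M L f) = f := by
  -- For `N = L` the projection is the identity and the form vanishes. The Gauss sum, the size of `N
  -- ∩ L` and the scalar by which `avg ψ L L` acts are all `q^n`.
  let p : L.space ≃ₗ[F] L.space := LinearEquiv.refl F L.space
  have hp : IsProjAlong M p := fun n => by simp [p]
  rw [hp.normAvg_normAvg hF hψ hL]
  have h1 : projMatrix p = 1 := by
    rw [projMatrix]
    exact LinearMap.toMatrix_id _
  have hcard : (Fintype.card L.space : ℂ) = (Fintype.card F : ℂ) ^ V.halfDim := by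
    rw [card_eq_pow_finrank (K := F), L.finrank_space]
    push_cast
    rfl
  have h2 : Nat.card (L.space.comap L.space.subtype) = Fintype.card L.space := by
    rw [Submodule.comap_subtype_self, Nat.card_congr Submodule.topEquiv.toEquiv,
      Nat.card_eq_fintype_card]
  have h3 : ∑ n : L.space, ψ (2⁻¹ * projForm p n n) = Fintype.card L.space := by
    rw [Finset.sum_congr rfl (g := fun _ => (1 : ℂ)) fun n _ => ?_]
    · simp
    · rw [projForm_apply, LinearEquiv.refl_apply, V.isAlt, mul_zero, AddChar.map_zero_eq_one]
  have h4 : avg ψ L L f = (Fintype.card L.space : ℂ) • f := by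
    refine Subtype.ext (funext fun h => ?_)
    rw [avg_apply, Finset.sum_congr rfl (g := fun _ => f.1 h) fun (l : L.space) _ => f.2.2 l.1 l.2 h]
    simp
  have hq := card_ne_zero_complex (F := F)
  rw [h1, h2, h3, h4, Matrix.det_one, mul_one, sgn_mul, sgn_mul_self L.scale_ne_zero, hcard,
    smul_smul]
  have h5 : ((Fintype.card F : ℂ)⁻¹) ^ V.halfDim * ((Fintype.card F : ℂ) ^ V.halfDim)⁻¹ *
      (1 * (Fintype.card F : ℂ) ^ V.halfDim) * (Fintype.card F : ℂ) ^ V.halfDim = 1 := by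
    rw [inv_pow]
    field_simp
  rw [h5, one_smul]

/-! ### The canonical intertwining morphisms -/

omit [Fintype F] [DecidableEq F] in
theorem exists_common_transversal_olag [Finite F] (hF : ringChar F ≠ 2) (L₁ L₂ L₃ : OLag V) :
    ∃ A : OLag V, L₁.space ⊔ A.space = ⊤ ∧ L₂.space ⊔ A.space = ⊤ ∧ L₃.space ⊔ A.space = ⊤ := by
  obtain ⟨A, hA, h₁, h₂, h₃⟩ := exists_common_transversal (Ring.two_ne_zero hF) L₁.isLagrangian
    L₂.isLagrangian L₃.isLagrangian
  obtain ⟨A', rfl⟩ := exists_olag hA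
  exact ⟨A', h₁, h₂, h₃⟩

/-- The existence of the canonical intertwining morphisms. -/
theorem exists_isCanonical (hF : ringChar F ≠ 2) (hψ : ψ ≠ 1) (V : Symp.{u, v} F) :
    ∃ T : ∀ M L : OLag V, model ψ L →ₗ[ℂ] model ψ M, IsCanonical ψ T := by
  choose A hA₁ hA₂ _ using fun L M : OLag V => exists_common_transversal_olag hF L M M
  let T : ∀ M L : OLag V, model ψ L →ₗ[ℂ] model ψ M :=
    fun M L => normAvg ψ M (A L M) ∘ₗ normAvg ψ (A L M) L
  have hT : ∀ {M L B : OLag V}, L.space ⊔ B.space = ⊤ → M.space ⊔ B.space = ⊤ →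
      ∀ f, T M L f = normAvg ψ M B (normAvg ψ B L f) :=
    fun hL hM f => normAvg_normAvg_eq hF hψ (hA₁ _ _) (hA₂ _ _) hL hM f
  have hself : ∀ L f, T L L f = f := fun L f => normAvg_normAvg_self hF hψ (hA₁ L L) f
  have hmul : ∀ N M L f, T N M (T M L f) = T N L f := by
    intro N M L f
    -- With one auxiliary Lagrangian for all three morphisms, the inner factors from `B` to `M` and
    -- back to `B` cancel.
    obtain ⟨B, hN, hM, hL⟩ := exists_common_transversal_olag hF N M L
    rw [hT hL hM, hT hM hN, hT hL hN, normAvg_normAvg_self hF hψ (sup_comm _ _ |>.trans hM)]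
  refine ⟨T, ⟨⟨fun M L => ⟨?_, ?_⟩, fun M L h f => ?_, fun N M L => LinearMap.ext (hmul N M L)⟩,
    fun M L hLM f h => ?_⟩⟩
  · exact Function.LeftInverse.injective (g := T L M) fun f => (hmul L M L f).trans (hself L f)
  · exact Function.RightInverse.surjective (g := T L M) fun f => (hmul M L M f).trans (hself M f)
  · simp only [T, LinearMap.comp_apply, normAvg_apply, avg_heisRep, map_smul]
  · obtain ⟨B, hL, hM, -⟩ := exists_common_transversal_olag hF L M M
    rw [hT hL hM, normAvg_normAvg_of_sup_eq_top hF hψ hL hM hLM, finsum_eq_sum_of_fintype]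
    rfl

theorem IsCanonical.eq_normAvg {T : ∀ M L : OLag V, model ψ L →ₗ[ℂ] model ψ M}
    (hT : IsCanonical ψ T) {M L : OLag V} (h : L.space ⊔ M.space = ⊤) (f : model ψ L) :
    T M L f = normAvg ψ M L f := by
  refine Subtype.ext (funext fun a => ?_)
  rw [hT.apply_of_sup_eq_top M L h, finsum_eq_sum_of_fintype]
  rfl

/-- The uniqueness of the canonical intertwining morphisms. -/
theorem IsCanonical.eq (hF : ringChar F ≠ 2) {T T' : ∀ M L : OLag V, model ψ L →ₗ[ℂ] model ψ M}
    (hT : IsCanonical ψ T) (hT' : IsCanonical ψ T') : T = T' := by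
  funext M L
  -- Both systems factor through `A`, where the formula for transversal pairs determines them.
  obtain ⟨A, hM, hL, -⟩ := exists_common_transversal_olag hF M L L
  rw [← hT.mul M A L, ← hT'.mul M A L]
  refine LinearMap.ext fun f => ?_
  rw [LinearMap.comp_apply, LinearMap.comp_apply, hT.eq_normAvg hL, hT'.eq_normAvg hL,
    hT.eq_normAvg (sup_comm _ _ |>.trans hM), hT'.eq_normAvg (sup_comm _ _ |>.trans hM)]

end

section

variable {F : Type v} [Field F] {V : Symp.{u, v} F} {ψ : AddChar F ℂ}

/-! ### The pairing of models -/

/-- The same oriented Lagrangian in `V̄`. -/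
def OLag.dual (L : OLag V) : OLag V.dual where
  space := L.space
  isLagrangian := by
    refine Eq.trans ?_ L.isLagrangian
    ext x
    exact forall₂_congr fun y _ => neg_eq_zero
  orient := L.orient
  orient_mem := L.orient_mem
  orient_ne_zero := L.orient_ne_zero

theorem wedgeForm_dual (k : ℕ) (a b : ⋀[F]^k V) :
    V.dual.wedgeForm k a b = (-1) ^ k * V.wedgeForm k a b := by
  have key : exteriorPower.pairingDual F V k ∘ₗ exteriorPower.map k (-V.form)
      = ((-1) ^ k : F) • (exteriorPower.pairingDual F V k ∘ₗ exteriorPower.map k V.form) := by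
    refine exteriorPower.linearMap_ext (AlternatingMap.ext fun x => ?_)
    refine exteriorPower.linearMap_ext (AlternatingMap.ext fun y => ?_)
    simp only [LinearMap.compAlternatingMap_apply, LinearMap.comp_apply, LinearMap.smul_apply,
      exteriorPower.map_apply_ιMulti, exteriorPower.pairingDual_ιMulti_ιMulti, smul_eq_mul]
    have h := Matrix.det_neg (Matrix.of fun i j => ((⇑V.form ∘ x) j) (y i))
    rw [Fintype.card_fin] at h
    exact h
  unfold wedgeForm
  rw [mul_left_comm]
  congr 1
  exact LinearMap.congr_fun (LinearMap.congr_fun key a) b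

/-- A vector of `V`, as an element of the Heisenberg group of `V̄`. -/
def Heis.ofVecDual (w : V) : Heis V.dual := Heis.ofVec (V := V.dual) w

/-- The pairing `∑_v f(v, 0) g(v, 0)` between the models for `V̄` and `V`. -/
def modelPairing [Finite F] (ψ : AddChar F ℂ) (L : OLag V) :
    model ψ L.dual →ₗ[ℂ] model ψ L →ₗ[ℂ] ℂ :=
  LinearMap.mk₂ ℂ (fun f g => ∑ w : V, f.1 (Heis.ofVecDual w) * g.1 (Heis.ofVec w))
    (fun f f' g => by simp [add_mul, Finset.sum_add_distrib])
    (fun c f g => by simp [Finset.mul_sum, mul_assoc])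
    (fun f g g' => by simp [mul_add, Finset.sum_add_distrib])
    (fun c f g => by simp [Finset.mul_sum, mul_left_comm])

theorem modelPairing_apply [Finite F] (L : OLag V) (f : model ψ L.dual) (g : model ψ L) :
    modelPairing ψ L f g = ∑ w : V, f.1 (Heis.ofVecDual w) * g.1 (Heis.ofVec w) := rfl

theorem model_ofVec_mul {L : OLag V} (f : model ψ L) (a b : V) :
    f.1 (Heis.ofVec a * Heis.ofVec b) = ψ (2⁻¹ * V.form a b) * f.1 (Heis.ofVec (a + b)) := by
  have := model_ofVec_mul_ofVec_mul f a b 1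
  rwa [mul_one, mul_one] at this

theorem model_ofVec_add {L : OLag V} (f : model ψ L) {l : V} (hl : l ∈ L.space) (a : V) :
    f.1 (Heis.ofVec (l + a)) = ψ (-(2⁻¹ * V.form l a)) * f.1 (Heis.ofVec a) := by
  have := model_ofVec_add_mul f hl a 1
  rwa [mul_one, mul_one] at this

theorem model_ofVecDual_mul {L : OLag V.dual} (f : model ψ L) (a b : V) :
    f.1 (Heis.ofVecDual a * Heis.ofVecDual b)
      = ψ (-(2⁻¹ * V.form a b)) * f.1 (Heis.ofVecDual (a + b)) := by
  rw [← mul_neg]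
  exact model_ofVec_mul f a b

theorem model_ofVecDual_add {L : OLag V} (f : model ψ L.dual) {l : V} (hl : l ∈ L.space) (a : V) :
    f.1 (Heis.ofVecDual (l + a)) = ψ (2⁻¹ * V.form l a) * f.1 (Heis.ofVecDual a) := by
  rw [← neg_neg (2⁻¹ * V.form l a), ← mul_neg]
  exact model_ofVec_add f hl a

/-- Some `l ∈ L` pairs non-trivially with `m`; translating `w` by a multiple of `l` shows that the
sum equals itself times a value of `ψ` different from `1`. -/
theorem sum_mul_eq_zero [Finite F] (h2 : (2 : F) ≠ 0) (hψ : ψ ≠ 1) {L : OLag V}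
    (f : model ψ L.dual) (g : model ψ L) {m : V} (hm : m ∉ L.space) :
    ∑ w : V, f.1 (Heis.ofVecDual w) * g.1 (Heis.ofVec m * Heis.ofVec w) = 0 := by
  obtain ⟨l, hl, hml⟩ : ∃ l ∈ L.space, V.form m l ≠ 0 := by
    by_contra! h
    exact hm (L.mem_of_forall_form_eq_zero h)
  obtain ⟨c, hc⟩ := AddChar.ne_one_iff.1 hψ
  let t : F := c / V.form m l
  have htl : t • l ∈ L.space := L.space.smul_mem t hl
  have hmt : V.form m (t • l) = c := by
    rw [map_smul, smul_eq_mul, div_mul_cancel₀ _ hml]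
  set S := ∑ w : V, f.1 (Heis.ofVecDual w) * g.1 (Heis.ofVec m * Heis.ofVec w) with hS
  have h : S = ψ c * S := by
    rw [hS, Finset.mul_sum]
    refine (Fintype.sum_equiv (Equiv.addLeft (t • l)) _ _ fun w => ?_).symm
    have h2 : m + (t • l + w) = t • l + (m + w) := by abel
    rw [Equiv.coe_addLeft, model_ofVec_mul, model_ofVec_mul, h2, model_ofVec_add g htl,
      model_ofVecDual_add f htl]
    have h3 : V.form (t • l) m = -c := by rw [form_eq_neg, hmt]
    have h4 : ψ c * ψ (2⁻¹ * V.form m w) = ψ (2⁻¹ * V.form (t • l) w) *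
        (ψ (2⁻¹ * V.form m (t • l + w)) * ψ (-(2⁻¹ * V.form (t • l) (m + w)))) := by
      rw [← AddChar.map_add_eq_mul, ← AddChar.map_add_eq_mul, ← AddChar.map_add_eq_mul,
        map_add (V.form m), map_add (V.form (t • l)), hmt, h3]
      congr 1
      field_simp
      ring
    linear_combination (f.1 (Heis.ofVecDual w) * g.1 (Heis.ofVec (m + w))) * h4
  have h5 : (1 - ψ c) * S = 0 := by linear_combination h
  exact (mul_eq_zero.1 h5).resolve_left (sub_ne_zero.2 (Ne.symm hc))

/-- In the expanded double sum over `M`, translating `w` removes one of the two variables and gives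
the factor `|M|`. In the other variable only `0` contributes, because `M ∩ L = 0`. -/
theorem modelPairing_avg_avg [Finite F] (h2 : (2 : F) ≠ 0) (hψ : ψ ≠ 1) {L M : OLag V}
    (hLM : L.space ⊔ M.space = ⊤) (f : model ψ L.dual) (g : model ψ L) :
    modelPairing ψ M (avg ψ M.dual L.dual f) (avg ψ M L g)
      = Fintype.card M.space * modelPairing ψ L f g := by
  have hinf := (sup_eq_top_iff_inf_eq_bot L.isLagrangian M.isLagrangian).1 hLM
  have e1 : ∀ w : V, (avg ψ M.dual L.dual f).1 (Heis.ofVecDual w)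
      = ∑ m : M.space, f.1 (Heis.ofVecDual (m : V) * Heis.ofVecDual w) := fun _ => rfl
  simp only [modelPairing_apply, e1, avg_apply, Finset.sum_mul_sum]
  rw [Finset.sum_comm]
  have e2 : ∀ m : M.space, ∑ w : V, ∑ m' : M.space,
      f.1 (Heis.ofVecDual (m : V) * Heis.ofVecDual w) * g.1 (Heis.ofVec (m' : V) * Heis.ofVec w)
      = ∑ w : V, ∑ m' : M.space,
        f.1 (Heis.ofVecDual w) * g.1 (Heis.ofVec (m' : V) * Heis.ofVec w) := by
    intro m
    refine Fintype.sum_equiv (Equiv.addLeft (m : V)) _ _ fun w => ?_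
    refine Fintype.sum_equiv (Equiv.subRight m) _ _ fun m' => ?_
    have e3 : ((m' - m : M.space) : V) + (m + w) = m' + w := by
      rw [Submodule.coe_sub]; abel
    rw [Equiv.coe_addLeft, Equiv.subRight_apply, model_ofVec_mul, model_ofVec_mul, e3,
      model_ofVecDual_mul, Submodule.coe_sub, map_sub, LinearMap.sub_apply, map_add, map_add,
      M.form_eq_zero m'.2 m.2, M.form_eq_zero m.2 m.2]
    have e4 : ψ (2⁻¹ * (0 + V.form m' w - (0 + V.form m w)))
        = ψ (-(2⁻¹ * V.form m w)) * ψ (2⁻¹ * V.form m' w) := by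
      rw [← AddChar.map_add_eq_mul]
      congr 1
      ring
    rw [e4]
    ring
  rw [Finset.sum_congr rfl fun m _ => e2 m, Finset.sum_const, nsmul_eq_mul, Finset.card_univ,
    Finset.sum_comm, Finset.sum_eq_single 0]
  · have e5 : Heis.ofVec ((0 : M.space) : V) = 1 := rfl
    simp only [e5, one_mul]
  · intro m _ hm
    refine sum_mul_eq_zero h2 hψ f g fun hmL => hm (Subtype.ext (hinf.le ⟨hmL, m.2⟩))
  · simp

section Canonical

variable [Fintype F] [DecidableEq F]

/-- The orientation-dependent sign occurs twice and disappears; the `σ(-1)^n` from `-ω` cancels the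
one in `G₁^(2n) = σ(-1)^n q^n`. -/
theorem normConst_dual_mul (hF : ringChar F ≠ 2) (hψ : ψ ≠ 1) {L M : OLag V}
    (hLM : L.space ⊔ M.space = ⊤) : normConst ψ M.dual L.dual * normConst ψ M L
      = ((Fintype.card F : ℂ)⁻¹) ^ V.halfDim := by
  have h : normConst ψ M.dual L.dual = (gaussSumOne ψ / Fintype.card F) ^ V.halfDim *
      (sgn (-1 : F) ^ V.halfDim * sgn (L.scale * M.scale * (L.gram M).det)) := by
    change _ * sgn ((-1) ^ (V.halfDim.choose 2) *
      V.dual.wedgeForm V.halfDim L.orientV M.orientV) = _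
    rw [wedgeForm_dual, wedgeForm_orientV, mul_left_comm ((-1) ^ V.halfDim), ← mul_assoc,
      ← mul_pow, neg_one_mul, neg_neg, one_pow, one_mul, sgn_mul, sgn_pow]
    rfl
  have hne : L.scale * M.scale * (L.gram M).det ≠ 0 :=
    mul_ne_zero (mul_ne_zero L.scale_ne_zero M.scale_ne_zero) (OLag.gram_det_ne_zero hLM)
  rw [h, normConst_eq, mul_mul_mul_comm, ← mul_pow, gaussSumOne_div_card_mul_self hF hψ,
    mul_assoc (sgn (-1 : F) ^ _), sgn_mul_self hne, mul_one, ← mul_pow,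
    mul_right_comm (sgn (-1 : F)), sgn_mul_self (by simp), one_mul]

/-- The pairings of the models are compatible with the normalized operators. -/
theorem modelPairing_normAvg (hF : ringChar F ≠ 2) (hψ : ψ ≠ 1) {L M : OLag V}
    (hLM : L.space ⊔ M.space = ⊤) (f : model ψ L.dual) (g : model ψ L) :
    modelPairing ψ M (normAvg ψ M.dual L.dual f) (normAvg ψ M L g) = modelPairing ψ L f g := by
  have hcard : (Fintype.card M.space : ℂ) = (Fintype.card F : ℂ) ^ V.halfDim := by
    rw [card_eq_pow_finrank (K := F), M.finrank_space]
    push_cast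
    rfl
  rw [normAvg_apply, normAvg_apply, map_smul, map_smul, LinearMap.smul_apply, smul_smul,
    modelPairing_avg_avg (Ring.two_ne_zero hF) hψ hLM, hcard, smul_eq_mul,
    mul_comm (normConst ψ M L), normConst_dual_mul hF hψ hLM, ← mul_assoc, inv_pow,
    inv_mul_cancel₀ (pow_ne_zero _ card_ne_zero_complex), one_mul]

end Canonical

/-! ### Nondegeneracy -/

theorem model_apply {L : OLag V} (f : model ψ L) (h : Heis V) :
    f.1 h = ψ h.cen * f.1 (Heis.ofVec h.vec) := by
  rw [← f.2.1]
  exact congrArg f.1 (Heis.ext (by simp) (by simp))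

theorem model_eq_zero {L : OLag V} (f : model ψ L) (hf : ∀ w : V, f.1 (Heis.ofVec w) = 0) :
    f = 0 :=
  Subtype.ext (funext fun h => by rw [model_apply, hf, mul_zero]; rfl)

/-- The isomorphism `(v, z) ↦ (v, -z)` from `H(V̄)` to `H(V)`. -/
def Heis.flip (V : Symp.{u, v} F) : Heis V.dual ≃* Heis V where
  toFun h := ⟨h.vec, -h.cen⟩
  invFun h := (⟨h.vec, -h.cen⟩ : Heis V.dual)
  left_inv h := Heis.ext rfl (neg_neg _)
  right_inv h := Heis.ext rfl (neg_neg _)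
  map_mul' a b := Heis.ext rfl (by
    change -(a.cen + b.cen + 2⁻¹ * -(V.form a.vec b.vec))
      = -a.cen + -b.cen + 2⁻¹ * V.form a.vec b.vec
    ring)

theorem Heis.flip_ofCen (z : F) : Heis.flip V (Heis.ofCen z) = Heis.ofCen (-z) := rfl

theorem Heis.flip_ofVec (w : V) : Heis.flip V (Heis.ofVecDual w) = Heis.ofVec w :=
  Heis.ext rfl neg_zero

theorem Heis.flip_symm_ofCen (z : F) : (Heis.flip V).symm (Heis.ofCen z) = Heis.ofCen (-z) := rfl

theorem Heis.flip_symm_ofVec (w : V) : (Heis.flip V).symm (Heis.ofVec w) = Heis.ofVecDual w :=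
  Heis.ext rfl neg_zero

/-- The complex conjugate `(v, z) ↦ conj (f(v, -z))` of an element of a model for `V`, as an
element of the model for `V̄`. -/
def modelConj [Finite F] {L : OLag V} (f : model ψ L) : model ψ L.dual where
  val h := starRingEnd ℂ (f.1 (Heis.flip V h))
  property := by
    refine ⟨fun z h => ?_, fun l hl h => ?_⟩
    · beta_reduce
      rw [map_mul, Heis.flip_ofCen, f.2.1, map_mul, AddChar.map_neg_eq_conj, Complex.conj_conj]
    · exact congrArg _ ((congrArg f.1 ((map_mul (Heis.flip V) _ h).trans
        (congrArg (· * _) (Heis.flip_ofVec (V := V) l)))).trans (f.2.2 l hl _))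

/-- The complex conjugate `(v, z) ↦ conj (f(v, -z))` of an element of a model for `V̄`, as an
element of the model for `V`. -/
def modelConjDual [Finite F] {L : OLag V} (f : model ψ L.dual) : model ψ L where
  val h := starRingEnd ℂ (f.1 ((Heis.flip V).symm h))
  property := by
    refine ⟨fun z h => ?_, fun l hl h => ?_⟩
    · beta_reduce
      rw [map_mul, Heis.flip_symm_ofCen, f.2.1, map_mul, AddChar.map_neg_eq_conj,
        Complex.conj_conj]
    · beta_reduce
      rw [map_mul, Heis.flip_symm_ofVec]
      exact congrArg _ (f.2.2 l hl _)

/-- Since `ψ(-z)` is the conjugate of `ψ(z)`, conjugation exchanges the two models. Pairing with the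
conjugate gives `∑ |f(w,0)|²`, and these values determine `f`. -/
theorem modelPairing_nondegenerate [Finite F] (L : OLag V) :
    (modelPairing ψ L).Nondegenerate := by
  have key : ∀ c : V → ℂ, ∑ w : V, c w * starRingEnd ℂ (c w) = 0 → ∀ w, c w = 0 := by
    intro c hc w
    simp only [Complex.mul_conj] at hc
    rw [← Complex.ofReal_sum, Complex.ofReal_eq_zero,
      Finset.sum_eq_zero_iff_of_nonneg fun w _ => Complex.normSq_nonneg _] at hc
    exact Complex.normSq_eq_zero.1 (hc w (Finset.mem_univ w))
  constructor
  · intro f hf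
    refine model_eq_zero f (key (fun w => f.1 (Heis.ofVecDual w)) ?_)
    refine Eq.trans (Finset.sum_congr rfl fun w _ => ?_) (hf (modelConjDual f))
    exact congrArg (fun a => f.1 (Heis.ofVecDual w) * starRingEnd ℂ (f.1 a))
      (Heis.flip_symm_ofVec w).symm
  · intro g hg
    refine model_eq_zero g (key (fun w => g.1 (Heis.ofVec w)) ?_)
    refine Eq.trans (Finset.sum_congr rfl fun w _ => ?_) (hg (modelConj g))
    rw [mul_comm]
    exact congrArg (fun a => starRingEnd ℂ (g.1 a) * g.1 (Heis.ofVec w))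
      (Heis.flip_ofVec w).symm

/-! ### The pairing of canonical spaces -/

theorem nonempty_olag [Finite F] (V : Symp.{u, v} F) : Nonempty (OLag V) := by
  obtain ⟨A, hA⟩ := exists_isLagrangian V
  exact ⟨(exists_olag hA).choose⟩

section Canonical

variable [Fintype F] [DecidableEq F]

theorem canonicalSpace_apply_eq (hF : ringChar F ≠ 2) (hψ : ψ ≠ 1) {M L : OLag V}
    (h : L.space ⊔ M.space = ⊤) (x : canonicalSpace ψ V) :
    x.1 M = normAvg ψ M L (x.1 L) := by
  obtain ⟨T, hT⟩ := exists_isCanonical hF hψ V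
  rw [← x.2 T hT M L, hT.eq_normAvg h]

theorem canonicalSpace_eq_zero (hF : ringChar F ≠ 2) (hψ : ψ ≠ 1) (L : OLag V)
    {x : canonicalSpace ψ V} (hx : x.1 L = 0) : x = 0 := by
  obtain ⟨T, hT⟩ := exists_isCanonical hF hψ V
  refine Subtype.ext (funext fun M => ?_)
  rw [← x.2 T hT M L, hx, map_zero]
  rfl

/-- Uniqueness of the canonical system enters here, as the extended section must be horizontal for
every such system. -/
theorem exists_canonicalSpace_apply_eq (hF : ringChar F ≠ 2) (hψ : ψ ≠ 1) (L : OLag V)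
    (f : model ψ L) : ∃ x : canonicalSpace ψ V, x.1 L = f := by
  obtain ⟨T, hT⟩ := exists_isCanonical hF hψ V
  refine ⟨⟨fun M => T M L f, fun T' hT' N M => ?_⟩, ?_⟩
  · rw [hT'.eq hF hT]
    exact LinearMap.congr_fun (hT.mul N M L) f
  · exact (hT.bijective L L).1 (LinearMap.congr_fun (hT.mul L L L) f)

/-- The pairing of canonical spaces, computed in the models for `L°`. -/
def pairingAt (ψ : AddChar F ℂ) (L : OLag V) :
    canonicalSpace ψ V.dual →ₗ[ℂ] canonicalSpace ψ V →ₗ[ℂ] ℂ :=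
  (modelPairing ψ L).compl₁₂ (LinearMap.proj L.dual ∘ₗ (canonicalSpace ψ V.dual).subtype)
    (LinearMap.proj L ∘ₗ (canonicalSpace ψ V).subtype)

theorem pairingAt_apply (L : OLag V) (x : canonicalSpace ψ V.dual) (y : canonicalSpace ψ V) :
    pairingAt ψ L x y = modelPairing ψ L (x.1 L.dual) (y.1 L) := rfl

theorem pairingAt_eq_of_sup_eq_top (hF : ringChar F ≠ 2) (hψ : ψ ≠ 1) {L M : OLag V}
    (h : L.space ⊔ M.space = ⊤) : pairingAt ψ M = pairingAt ψ L := by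
  refine LinearMap.ext₂ fun x y => ?_
  rw [pairingAt_apply, pairingAt_apply, canonicalSpace_apply_eq hF hψ h y,
    canonicalSpace_apply_eq hF hψ (M := M.dual) (L := L.dual) h x,
    modelPairing_normAvg hF hψ h]

/-- The pairing of canonical spaces does not depend on the oriented Lagrangian. -/
theorem pairingAt_eq (hF : ringChar F ≠ 2) (hψ : ψ ≠ 1) (L M : OLag V) :
    pairingAt ψ M = pairingAt ψ L := by
  obtain ⟨A, hL, hM, -⟩ := exists_common_transversal_olag hF L M M
  rw [← pairingAt_eq_of_sup_eq_top hF hψ hM, pairingAt_eq_of_sup_eq_top hF hψ hL]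

/-- Evaluation at one oriented Lagrangian identifies each canonical space with a model, so
non-degeneracy is inherited from the models. -/
theorem pairingAt_nondegenerate (hF : ringChar F ≠ 2) (hψ : ψ ≠ 1) (L : OLag V) :
    (pairingAt ψ L).Nondegenerate := by
  obtain ⟨hl, hr⟩ := modelPairing_nondegenerate (ψ := ψ) L
  constructor
  · intro x hx
    refine canonicalSpace_eq_zero hF hψ L.dual (hl _ fun g => ?_)
    obtain ⟨y, rfl⟩ := exists_canonicalSpace_apply_eq hF hψ L g
    exact hx y
  · intro y hy
    refine canonicalSpace_eq_zero hF hψ L (hr _ fun f => ?_)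
    obtain ⟨x, rfl⟩ := exists_canonicalSpace_apply_eq hF hψ L.dual f
    exact hy x

/-- Substituting `w ↦ f w` matches the two sums term by term. -/
theorem pairingAt_canonicalSpaceMap {U : Symp.{u, v} F} (f : Iso V U) (L : OLag V)
    (x : canonicalSpace ψ U.dual) (y : canonicalSpace ψ U) :
    pairingAt ψ L (canonicalSpaceMap ψ f.dual x) (canonicalSpaceMap ψ f y)
      = pairingAt ψ (L.map f) x y :=
  Fintype.sum_equiv f.toEquiv.toEquiv _ _ fun _ => rfl

end Canonical

end

end Symp

end

theorem mainTheorem8 {F : Type v} [Field F] [Fintype F] [DecidableEq F] (hF : ringChar F ≠ 2)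
    (ψ : AddChar F ℂ) (hψ : ψ ≠ 1) :
    ∃ pairing : ∀ V : Symp.{u, v} F,
        Symp.canonicalSpace ψ V.dual →ₗ[ℂ] Symp.canonicalSpace ψ V →ₗ[ℂ] ℂ,
      (∀ V : Symp.{u, v} F, (pairing V).Nondegenerate) ∧
      ∀ (V U : Symp.{u, v} F) (f : Symp.Iso V U)
        (x : Symp.canonicalSpace ψ U.dual) (y : Symp.canonicalSpace ψ U),
        pairing V (Symp.canonicalSpaceMap ψ f.dual x) (Symp.canonicalSpaceMap ψ f y)
          = pairing U x y := by
  -- The Lagrangians are chosen without any compatibility with morphisms; `pairingAt_eq` makes the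
  -- choice harmless.
  obtain ⟨L⟩ := Classical.nonempty_pi.2 fun V : Symp.{u, v} F => Symp.nonempty_olag V
  refine ⟨fun V => Symp.pairingAt ψ (L V), fun V => Symp.pairingAt_nondegenerate hF hψ (L V),
    fun V U f x y => ?_⟩
  rw [Symp.pairingAt_canonicalSpaceMap, Symp.pairingAt_eq hF hψ (L U)]
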